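/- Let $(M,g)$ be a smooth $n$-dimensional pseudo-Riemannian manifold of arbitrary signature, with Levi-Civita connection $\nabla$. Let $2\le p<n$ and let $Y$ be a smooth $p$-form on $M$. Square (round) brackets denote antisymmetrization (symmetrization) with total weight one. A collective index $E=e_3\cdots e_p$ stands for $p-2$ indices. The Riemann tensor is normalized by $(\nabla_a\nabla_b-\nabla_b\nabla_a)\omega_c=R_{abc}{}^f\omega_f$, the Ricci tensor is $R_{ab}=R^c{}_{acb}$, the scalar curvature is $R=R^a{}_a$, and the Weyl tensor is $$C_{abcd}=R_{abcd}-\tfrac1{n-2}\bigl(g_{ac}R_{bd}-g_{ad}R_{bc}+g_{bd}R_{ac}-g_{bc}R_{ad}\bigr)+\tfrac{R}{(n-1)(n-2)}\bigl(g_{ac}g_{bd}-g_{ad}g_{bc}\bigr).$$ For a curvature-type tensor $K_{abcd}$ write $$K^{\hat f}{}_{\hat e xy}Y_{zw\hat F}=\sum_{i=3}^p K^f{}_{e_i xy}\,Y_{zw e_3\cdots f\cdots e_p},\qquad K^{a\hat f}{}_{\hat e c}Y_{da\hat F}=\sum_{i=3}^p K^{af}{}_{e_i c}\,Y_{da e_3\cdots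 f\cdots e_p},$$ with $f$ in the place of $e_i$ (these sums are empty for $p=2$). For a tensor $T_{cdE}$ define $$\begin{aligned} \mathcal I[K,T]_{abcdE}={}&K^f{}_{acb}Y_{dfE}+K^f{}_{bda}Y_{cfE}+K^f{}_{cad}Y_{bfE}+K^f{}_{dbc}Y_{afE}\\ &+K^{\hat f}{}_{\hat e[bc}Y_{d]a\hat F}+2K^{\hat f}{}_{\hat e a[b}Y_{cd]\hat F}+2K^{\hat f}{}_{\hat e bc}Y_{ad\hat F}-3K^{\hat f}{}_{\hat e[ab}Y_{c]d\hat F}\\ &+\tfrac2p\bigl(g_{ac}T_{bdE}+g_{bd}T_{acE}-g_{ab}T_{cdE}-g_{cd}T_{abE}\bigr)\\ &+\tfrac{2(p-2)}{3p}\bigl(T_{dcb[e_4\cdots e_p}g_{e_3]a}-T_{dbc[e_4\cdots e_p}g_{e_3]a}+T_{cda[e_4\cdots e_p}g_{e_3]b}-T_{cad[e_4\cdots e_p}g_{e_3]b}\\ &\qquad+T_{bad[e_4\cdots e_p}g_{e_3]c}-T_{bda[e_4\cdots e_p}g_{e_3]c}+T_{abc[e_4\cdots e_p}g_{e_3]d}-T_{acb[e_4\cdots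 e_p}g_{e_3]d}\bigr), \end{aligned}$$ where the last bracket is absent for $p=2$. Put $$W_{cdE}=\frac{p}{2(n-p)}\,C^{a\hat f}{}_{\hat e(c}Y_{d)a\hat F},\qquad \Sigma_{cdE}=\frac{p}{n-2}\,R^f{}_{(c}Y_{d)fE}+W_{cdE}.$$ (1) Suppose that $Y$ is a conformal Killing–Yano form, i.e. that there is a $(p-1)$-form $h$ with $$\nabla_aY_{b_1b_2\cdots b_p}+\nabla_{b_1}Y_{ab_2\cdots b_p}=2g_{a[b_1}h_{b_2\cdots b_p]}+2g_{b_1[a}h_{b_2\cdots b_p]}.$$ Then $h$ is the normalized divergence, $h_{b_2\cdots b_p}=\frac{p}{2(n+1-p)}\nabla^aY_{ab_2\cdots b_p}$, and is in particular smooth. Let $S_{cdE}=\nabla_ch_{dE}+\nabla_dh_{cE}$. Then $$S_{cdE}=\frac{p}{n-p}\Bigl[R^f{}_{(c}Y_{d)fE}+\tfrac12R^{a\hat f}{}_{\hat e(c}Y_{d)a\hat F}\Bigr]=\Sigma_{cdE},$$ the identity $\mathcal I[R,S]=0$ holds, and consequently $Y$ satisfies the algebraic integrability conditions $\mathcal I[R,\Sigma]=0$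 and $$\mathcal I[C,W]=0,$$ where $\mathcal I[R,\cdot]$ and $\mathcal I[C,\cdot]$ are formed with the Riemann and with the Weyl tensor respectively. (2) All Ricci and scalar-curvature terms cancel in the condition obtained by substitution: for every smooth $p$-form $Y$ (conformal Killing–Yano or not), $\mathcal I[R,\Sigma]=\mathcal I[C,W]$. (3) $W$ is conformally invariant, in the sense that replacing $(g,Y)$ by $(\Omega^2g,\Omega^{p+1}Y)$, with $\Omega$ a smooth nowhere vanishing function, replaces $W$ by $\Omega^{p-1}W$. -/

import Mathlib

open scoped Manifold ContDiff

noncomputable section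

namespace CKY

/-! ### Tensor algebra in components

The components of a covariant tensor of rank `r` at a point of an `n`-manifold, with respect to a
coordinate frame, form a function `(Fin r → Fin n) → ℝ`.  The metric components form a matrix `G`,
and its inverse `G⁻¹` raises indices.  A curvature-like tensor is written `K a b c d`, all four
indices being down. -/

section Algebra

variable {n : ℕ}

/-- Antisymmetrization of indices (square brackets) with weight one:
`T_{[i₁ ⋯ i_r]} = (1 / r!) ∑_σ sgn(σ) T_{i_{σ 1} ⋯ i_{σ r}}`. -/
def antisym {r : ℕ} (T : (Fin r → Fin n) → ℝ) (I : Fin r → Fin n) : ℝ :=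
  (r.factorial : ℝ)⁻¹ *
    ∑ σ : Equiv.Perm (Fin r), ((Equiv.Perm.sign σ : ℤ) : ℝ) * T (fun j => I (σ j))

/-- Antisymmetrization `T_{[xyz]}` over three indices. -/
def antisym₃ (T : Fin n → Fin n → Fin n → ℝ) (x y z : Fin n) : ℝ :=
  antisym (fun J : Fin 3 → Fin n => T (J 0) (J 1) (J 2)) ![x, y, z]

/-- Symmetrization of two indices (round brackets) with weight one:
`T_{(cd)} = (T_{cd} + T_{dc}) / 2`. -/
def sym₂ (T : Fin n → Fin n → ℝ) (c d : Fin n) : ℝ := (T c d + T d c) / 2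

/-- The Ricci tensor `R_{ab} = R^c_{acb}` of a curvature tensor `K`. -/
def ricci (G : Matrix (Fin n) (Fin n) ℝ) (K : Fin n → Fin n → Fin n → Fin n → ℝ)
    (a b : Fin n) : ℝ :=
  ∑ c, ∑ d, G⁻¹ c d * K d a c b

/-- The scalar curvature `g^{ab} R_{ab}` of a curvature tensor `K`. -/
def scalar (G : Matrix (Fin n) (Fin n) ℝ) (K : Fin n → Fin n → Fin n → Fin n → ℝ) : ℝ :=
  ∑ a, ∑ b, G⁻¹ a b * ricci G K a b

/-- The Weyl tensor `C_{abcd}` of a curvature tensor `K = R_{abcd}` (for `n ≥ 3`). -/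
def weyl (G : Matrix (Fin n) (Fin n) ℝ) (K : Fin n → Fin n → Fin n → Fin n → ℝ)
    (a b c d : Fin n) : ℝ :=
  K a b c d
    - 1 / ((n : ℝ) - 2) *
      (G a c * ricci G K b d - G a d * ricci G K b c
        + G b d * ricci G K a c - G b c * ricci G K a d)
    + scalar G K / (((n : ℝ) - 1) * ((n : ℝ) - 2)) * (G a c * G b d - G a d * G b c)

/-- `K^f_{bcd}`: first index raised. -/
def raise₁ (G : Matrix (Fin n) (Fin n) ℝ) (K : Fin n → Fin n → Fin n → Fin n → ℝ)
    (f b c d : Fin n) : ℝ :=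
  ∑ f', G⁻¹ f f' * K f' b c d

/-- `K^{af}_{cd}`: first two indices raised. -/
def raise₂ (G : Matrix (Fin n) (Fin n) ℝ) (K : Fin n → Fin n → Fin n → Fin n → ℝ)
    (a f c d : Fin n) : ℝ :=
  ∑ a', ∑ f', G⁻¹ a a' * G⁻¹ f f' * K a' f' c d

variable {k : ℕ}

/-- `K^f_{xyz} Y_{wfE}` for a `p`-form `Y`, `p = k + 2`, and a collective index `E` consisting of
`p - 2 = k` indices. -/
def curvForm (G : Matrix (Fin n) (Fin n) ℝ) (K : Fin n → Fin n → Fin n → Fin n → ℝ)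
    (Y : (Fin (k + 2) → Fin n) → ℝ) (x y z w : Fin n) (E : Fin k → Fin n) : ℝ :=
  ∑ f, raise₁ G K f x y z * Y (Matrix.vecCons w (Matrix.vecCons f E))

/-- The hatted contraction `∑ᵢ K^f_{eᵢ xy} Y_{zw e₃ ⋯ f ⋯ e_p}`, the index `f` standing at the place
of `eᵢ`. -/
def curvFormHat (G : Matrix (Fin n) (Fin n) ℝ) (K : Fin n → Fin n → Fin n → Fin n → ℝ)
    (Y : (Fin (k + 2) → Fin n) → ℝ) (E : Fin k → Fin n) (x y z w : Fin n) : ℝ :=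
  ∑ i, ∑ f, raise₁ G K f (E i) x y *
    Y (Matrix.vecCons z (Matrix.vecCons w (Function.update E i f)))

/-- `R^f_{(c} Y_{d)fE}`, where `R^f_c` is the Ricci tensor of `K`. -/
def ricciForm (G : Matrix (Fin n) (Fin n) ℝ) (K : Fin n → Fin n → Fin n → Fin n → ℝ)
    (Y : (Fin (k + 2) → Fin n) → ℝ) (c d : Fin n) (E : Fin k → Fin n) : ℝ :=
  sym₂ (fun c d => ∑ f, (∑ f', G⁻¹ f f' * ricci G K f' c) *
    Y (Matrix.vecCons d (Matrix.vecCons f E))) c d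

/-- `∑ᵢ K^{af}_{eᵢ (c} Y_{d) a e₃ ⋯ f ⋯ e_p}`, the index `f` standing at the place of `eᵢ`. -/
def curvFormTrace (G : Matrix (Fin n) (Fin n) ℝ) (K : Fin n → Fin n → Fin n → Fin n → ℝ)
    (Y : (Fin (k + 2) → Fin n) → ℝ) (c d : Fin n) (E : Fin k → Fin n) : ℝ :=
  sym₂ (fun c d => ∑ i, ∑ a, ∑ f, raise₂ G K a f (E i) c *
    Y (Matrix.vecCons d (Matrix.vecCons a (Function.update E i f)))) c d

/-- `S_{xyz[e₄ ⋯ e_p} g_{e₃]w}`; it is absent for `p = 2`. -/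
def bracketTerm (G : Matrix (Fin n) (Fin n) ℝ) :
    {k : ℕ} → (Fin n → Fin n → (Fin k → Fin n) → ℝ) →
      Fin n → Fin n → Fin n → Fin n → (Fin k → Fin n) → ℝ
  | 0, _, _, _, _, _, _ => 0
  | _ + 1, S, x, y, z, w, E =>
      antisym (fun J => S x y (Matrix.vecCons z (fun j => J j.succ)) * G (J 0) w) E

/-- The right-hand side of the integrability identity of order `p = k + 2`, as a function of the
metric `G`, a curvature tensor `K`, a `p`-form `Y` and a tensor `S_{cdE}`. -/
def intCond (G : Matrix (Fin n) (Fin n) ℝ) (K : Fin n → Fin n → Fin n → Fin n → ℝ)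
    (Y : (Fin (k + 2) → Fin n) → ℝ) (S : Fin n → Fin n → (Fin k → Fin n) → ℝ)
    (a b c d : Fin n) (E : Fin k → Fin n) : ℝ :=
  curvForm G K Y a c b d E + curvForm G K Y b d a c E
    + curvForm G K Y c a d b E + curvForm G K Y d b c a E
    + antisym₃ (fun b c d => curvFormHat G K Y E b c d a) b c d
    + 2 * antisym₃ (fun b c d => curvFormHat G K Y E a b c d) b c d
    + 2 * curvFormHat G K Y E b c a d
    - 3 * antisym₃ (fun a b c => curvFormHat G K Y E a b c d) a b c
    + 2 / ((k : ℝ) + 2) *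
      (G a c * S b d E + G b d * S a c E - G a b * S c d E - G c d * S a b E)
    + 2 * (k : ℝ) / (3 * ((k : ℝ) + 2)) *
      (bracketTerm G S d c b a E - bracketTerm G S d b c a E
        + bracketTerm G S c d a b E - bracketTerm G S c a d b E
        + bracketTerm G S b a d c E - bracketTerm G S b d a c E
        + bracketTerm G S a b c d E - bracketTerm G S a c b d E)

/-- `(p / (n - p)) (R^f_{(c} Y_{d)fE} + (1/2) ∑ᵢ R^{af}_{eᵢ (c} Y_{d) a e₃ ⋯ f ⋯ e_p})`,
`p = k + 2`. -/
def riemannExpr (G : Matrix (Fin n) (Fin n) ℝ) (R : Fin n → Fin n → Fin n → Fin n → ℝ)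
    (Y : (Fin (k + 2) → Fin n) → ℝ) (c d : Fin n) (E : Fin k → Fin n) : ℝ :=
  ((k : ℝ) + 2) / ((n : ℝ) - ((k : ℝ) + 2)) *
    (ricciForm G R Y c d E + 1 / 2 * curvFormTrace G R Y c d E)

/-- `W_{cdE} = (p / (2 (n - p))) ∑ᵢ C^{af}_{eᵢ (c} Y_{d) a e₃ ⋯ f ⋯ e_p}`, where `C` is the Weyl
tensor of `R` and `p = k + 2`. -/
def weylExpr (G : Matrix (Fin n) (Fin n) ℝ) (R : Fin n → Fin n → Fin n → Fin n → ℝ)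
    (Y : (Fin (k + 2) → Fin n) → ℝ) (c d : Fin n) (E : Fin k → Fin n) : ℝ :=
  ((k : ℝ) + 2) / (2 * ((n : ℝ) - ((k : ℝ) + 2))) * curvFormTrace G (weyl G R) Y c d E

/-- `(p / (n - 2)) R^f_{(c} Y_{d)fE} + W_{cdE}`, `p = k + 2`. -/
def ricciWeylExpr (G : Matrix (Fin n) (Fin n) ℝ) (R : Fin n → Fin n → Fin n → Fin n → ℝ)
    (Y : (Fin (k + 2) → Fin n) → ℝ) (c d : Fin n) (E : Fin k → Fin n) : ℝ :=
  ((k : ℝ) + 2) / ((n : ℝ) - 2) * ricciForm G R Y c d E + weylExpr G R Y c d E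

end Algebra

/-! ### Tensor calculus in a coordinate system -/

section Calculus

variable {n : ℕ}

/-- The partial derivative `∂_a f` at `u`. -/
def pderiv (a : Fin n) (f : EuclideanSpace ℝ (Fin n) → ℝ) (u : EuclideanSpace ℝ (Fin n)) : ℝ :=
  fderiv ℝ f u (EuclideanSpace.single a 1)

/-- The Christoffel symbols `Γ^c_{ab}` of the Levi-Civita connection. -/
def christoffel (g : EuclideanSpace ℝ (Fin n) → Matrix (Fin n) (Fin n) ℝ)
    (u : EuclideanSpace ℝ (Fin n)) (c a b : Fin n) : ℝ :=
  1 / 2 * ∑ d, (g u)⁻¹ c d *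
    (pderiv a (fun v => g v d b) u + pderiv b (fun v => g v d a) u - pderiv d (fun v => g v a b) u)

/-- The Levi-Civita covariant derivative
`∇_a T_{b₁ ⋯ b_r} = ∂_a T_{b₁ ⋯ b_r} - ∑ᵢ Γ^f_{a bᵢ} T_{b₁ ⋯ f ⋯ b_r}`. -/
def covDeriv (g : EuclideanSpace ℝ (Fin n) → Matrix (Fin n) (Fin n) ℝ) {r : ℕ}
    (T : EuclideanSpace ℝ (Fin n) → (Fin r → Fin n) → ℝ) (u : EuclideanSpace ℝ (Fin n))
    (a : Fin n) (I : Fin r → Fin n) : ℝ :=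
  pderiv a (fun v => T v I) u
    - ∑ i, ∑ f, christoffel g u f a (I i) * T u (Function.update I i f)

/-- The Riemann tensor `R_{abc}{}^f`, normalized by
`(∇_a ∇_b - ∇_b ∇_a) ω_c = R_{abc}{}^f ω_f`. -/
def riemannMixed (g : EuclideanSpace ℝ (Fin n) → Matrix (Fin n) (Fin n) ℝ)
    (u : EuclideanSpace ℝ (Fin n)) (a b c f : Fin n) : ℝ :=
  pderiv b (fun v => christoffel g v f a c) u - pderiv a (fun v => christoffel g v f b c) u
    + ∑ e, (christoffel g u e a c * christoffel g u f b e
      - christoffel g u e b c * christoffel g u f a e)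

/-- The Riemann tensor `R_{abcd} = R_{abc}{}^f g_{fd}`. -/
def riemann (g : EuclideanSpace ℝ (Fin n) → Matrix (Fin n) (Fin n) ℝ)
    (u : EuclideanSpace ℝ (Fin n)) (a b c d : Fin n) : ℝ :=
  ∑ f, riemannMixed g u a b c f * g u f d

/-- For a form `Y` of order `p = m + 1`, the normalized divergence
`h_{b₂ ⋯ b_p} = (p / (2 (n + 1 - p))) ∇^a Y_{a b₂ ⋯ b_p}`. -/
def divergence {m : ℕ} (g : EuclideanSpace ℝ (Fin n) → Matrix (Fin n) (Fin n) ℝ)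
    (Y : EuclideanSpace ℝ (Fin n) → (Fin (m + 1) → Fin n) → ℝ)
    (u : EuclideanSpace ℝ (Fin n)) (B : Fin m → Fin n) : ℝ :=
  ((m : ℝ) + 1) / (2 * ((n : ℝ) + 1 - ((m : ℝ) + 1))) *
    ∑ a, ∑ b, (g u)⁻¹ a b * covDeriv g Y u a (Matrix.vecCons b B)

/-- For a form `h` of order `p - 1 = k + 1`, the symmetrized derivative
`S_{cdE} = ∇_c h_{dE} + ∇_d h_{cE}`. -/
def symDeriv {k : ℕ} (g : EuclideanSpace ℝ (Fin n) → Matrix (Fin n) (Fin n) ℝ)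
    (h : EuclideanSpace ℝ (Fin n) → (Fin (k + 1) → Fin n) → ℝ)
    (u : EuclideanSpace ℝ (Fin n)) (c d : Fin n) (E : Fin k → Fin n) : ℝ :=
  covDeriv g h u c (Matrix.vecCons d E) + covDeriv g h u d (Matrix.vecCons c E)

/-- `g_{x[y} h_{b₂ ⋯ b_p]}`. -/
def metricWedge {m : ℕ} (G : Matrix (Fin n) (Fin n) ℝ) (h : (Fin m → Fin n) → ℝ)
    (x y : Fin n) (B : Fin m → Fin n) : ℝ :=
  antisym (fun J : Fin (m + 1) → Fin n => G x (J 0) * h (fun j => J j.succ)) (Matrix.vecCons y B)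

end Calculus

/-! ### Metrics and forms on manifolds -/

section Manifold

variable {n : ℕ} {M : Type*} [TopologicalSpace M] [ChartedSpace (EuclideanSpace ℝ (Fin n)) M]

/-- The coordinate vector field `∂_i` of the chart `e`, at the point with coordinates `u`. -/
def coordFrame (e : OpenPartialHomeomorph M (EuclideanSpace ℝ (Fin n)))
    (u : EuclideanSpace ℝ (Fin n)) (i : Fin n) : TangentSpace (𝓡 n) (e.symm u) :=
  mfderiv (𝓡 n) (𝓡 n) e.symm u (EuclideanSpace.single i (1 : ℝ))

/-- The components of a field of bilinear forms in the chart `e`. -/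
def bilinComp (b : ∀ x : M, LinearMap.BilinForm ℝ (TangentSpace (𝓡 n) x))
    (e : OpenPartialHomeomorph M (EuclideanSpace ℝ (Fin n))) (u : EuclideanSpace ℝ (Fin n)) :
    Matrix (Fin n) (Fin n) ℝ :=
  Matrix.of fun i j => b (e.symm u) (coordFrame e u i) (coordFrame e u j)

/-- The components of a field of alternating `r`-forms in the chart `e`. -/
def formComp {r : ℕ} (α : ∀ x : M, TangentSpace (𝓡 n) x [⋀^Fin r]→ₗ[ℝ] ℝ)
    (e : OpenPartialHomeomorph M (EuclideanSpace ℝ (Fin n))) (u : EuclideanSpace ℝ (Fin n))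
    (I : Fin r → Fin n) : ℝ :=
  α (e.symm u) (fun j => coordFrame e u (I j))

variable (n M) in
/-- A smooth metric of arbitrary signature on an `n`-manifold. -/
structure Metric [IsManifold (𝓡 n) ∞ M] where
  /-- the bilinear form on each tangent space -/
  form : ∀ x : M, LinearMap.BilinForm ℝ (TangentSpace (𝓡 n) x)
  symm : ∀ (x : M) (v w : TangentSpace (𝓡 n) x), form x v w = form x w v
  nondegenerate : ∀ (x : M) (v : TangentSpace (𝓡 n) x), (∀ w, form x v w = 0) → v = 0
  smooth : ∀ e ∈ IsManifold.maximalAtlas (𝓡 n) ∞ M, ∀ i j : Fin n,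
    ContDiffOn ℝ ∞ (fun u => bilinComp form e u i j) e.target

/-- The metric components `g_{ij}` in the chart `e`. -/
def Metric.comp [IsManifold (𝓡 n) ∞ M] (g : Metric n M)
    (e : OpenPartialHomeomorph M (EuclideanSpace ℝ (Fin n))) :
    EuclideanSpace ℝ (Fin n) → Matrix (Fin n) (Fin n) ℝ :=
  bilinComp g.form e

/-- Smoothness of a field of alternating forms. -/
def IsSmoothForm [IsManifold (𝓡 n) ∞ M] {r : ℕ}
    (α : ∀ x : M, TangentSpace (𝓡 n) x [⋀^Fin r]→ₗ[ℝ] ℝ) : Prop :=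
  ∀ e ∈ IsManifold.maximalAtlas (𝓡 n) ∞ M, ∀ I : Fin r → Fin n,
    ContDiffOn ℝ ∞ (fun u => formComp α e u I) e.target

/-- `Y` is a conformal Killing–Yano form of order `p = m + 1` with associated form `h` of order
`p - 1`: in all coordinate systems,
`∇_a Y_{b₁ b₂ ⋯ b_p} + ∇_{b₁} Y_{a b₂ ⋯ b_p} = 2 g_{a[b₁} h_{b₂ ⋯ b_p]} + 2 g_{b₁[a} h_{b₂ ⋯ b_p]}`.
No regularity of `h` is required. -/
def IsConformalKillingYano [IsManifold (𝓡 n) ∞ M] {m : ℕ} (g : Metric n M)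
    (Y : ∀ x : M, TangentSpace (𝓡 n) x [⋀^Fin (m + 1)]→ₗ[ℝ] ℝ)
    (h : ∀ x : M, TangentSpace (𝓡 n) x [⋀^Fin m]→ₗ[ℝ] ℝ) : Prop :=
  ∀ e ∈ IsManifold.maximalAtlas (𝓡 n) ∞ M, ∀ u ∈ e.target,
    ∀ (a b : Fin n) (B : Fin m → Fin n),
      covDeriv (g.comp e) (formComp Y e) u a (Matrix.vecCons b B)
          + covDeriv (g.comp e) (formComp Y e) u b (Matrix.vecCons a B)
        = 2 * metricWedge (g.comp e u) (formComp h e u) a b B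
          + 2 * metricWedge (g.comp e u) (formComp h e u) b a B

end Manifold

end CKY

end

noncomputable section

namespace CKY

/-! All computations take place in the components of a chart, with p = k + 2.

Differential part. As with Killing vectors, the second derivatives of Y are determined
algebraically. Differentiating the conformal Killing–Yano equation once more and combining three
copies of it with the Ricci identity, in the manner of the Koszul formula, expresses ∇_c∇_a Y_{bdE}
through the curvature acting on Y and through g ∧ ∇h. The left side is antisymmetric in b and d, and
imposing this on the right side leaves an algebraic identity in which ∇h survives only as S: the
vanishing of `symCond` (`symCond_of_secondDeriv`). Antisymmetrizing it in two indices gives 3 I[R,S]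
= 0 (`three_mul_intCond`). Its metric trace is a linear equation for S with leading coefficient -2(n
- p), up to traces of S; a second trace shows that S is trace-free, and S is then expressed by the
curvature and Y (`eq_riemannExpr_of_symCond`).

Algebraic part. I[K,T] is additive in the pair (K,T). Writing R = C + g ∧ P, with P the Schouten
tensor and ∧ the Kulkarni–Nomizu product, turns Σ into W + p P^f_{(c}Y_{d)fE}. Hence the Ricci terms
cancel because I[g ∧ P, p P^f_{(c}Y_{d)fE}] = 0 for every symmetric P (`intCond_knProd`). The same
splitting identifies the two formulas for S (`riemannExpr_eq_ricciWeylExpr`).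

Conformal part. Under g' = Ω²g the Riemann tensor becomes Ω²(R + g ∧ L) with L symmetric
(`IsMetricOn.riemann_conformal`), so the lowered Weyl tensor scales by Ω² (`weyl_conformal`), and
the weight of W is found by counting inverse metrics. -/

/-- A covariant tensor that changes by the sign under permutations of its indices. -/
def IsAlt {n r : ℕ} (T : (Fin r → Fin n) → ℝ) : Prop :=
  ∀ (σ : Equiv.Perm (Fin r)) (I : Fin r → Fin n),
    T (I ∘ σ) = ((Equiv.Perm.sign σ : ℤ) : ℝ) * T I

/-! ### Alternating component tensors and explicit antisymmetrizations. -/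

section Index

variable {n : ℕ}

theorem IsAlt.swap {r : ℕ} {T : (Fin r → Fin n) → ℝ} (hT : IsAlt T) {i j : Fin r} (hij : i ≠ j)
    (I : Fin r → Fin n) : T (I ∘ Equiv.swap i j) = - T I := by
  rw [hT, Equiv.Perm.sign_swap hij]; simp

theorem vecCons_comp_swap {r : ℕ} (x : Fin n) (E : Fin r → Fin n) (i : Fin r) :
    (Matrix.vecCons x E) ∘ Equiv.swap 0 i.succ = Matrix.vecCons (E i) (Function.update E i x) := by
  funext j
  refine Fin.cases ?_ (fun j => ?_) j
  · simp
  · by_cases h : j = i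
    · subst h; simp
    · have : Equiv.swap 0 i.succ j.succ = j.succ :=
        Equiv.swap_apply_of_ne_of_ne (Fin.succ_ne_zero _) (by simpa using h)
      simp [this, h]

theorem IsAlt.vecCons_update {r : ℕ} {T : (Fin (r + 1) → Fin n) → ℝ} (hT : IsAlt T)
    (x y : Fin n) (E : Fin r → Fin n) (i : Fin r) :
    T (Matrix.vecCons x (Function.update E i y))
      = - T (Matrix.vecCons y (Function.update E i x)) := by
  rw [← hT.swap (Fin.succ_ne_zero i).symm, vecCons_comp_swap]
  simp

theorem vecCons_comp_decompose {r : ℕ} (x : Fin n) (E : Fin r → Fin n) (σ : Equiv.Perm (Fin r)) :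
    (Matrix.vecCons x E) ∘ Equiv.Perm.decomposeFin.symm (0, σ) = Matrix.vecCons x (E ∘ σ) := by
  funext j
  refine Fin.cases ?_ (fun j => ?_) j <;> simp

theorem IsAlt.vecCons {r : ℕ} {T : (Fin (r + 1) → Fin n) → ℝ} (hT : IsAlt T) (x : Fin n) :
    IsAlt (fun E => T (Matrix.vecCons x E)) := by
  intro σ I
  have := hT (Equiv.Perm.decomposeFin.symm (0, σ)) (Matrix.vecCons x I)
  rw [vecCons_comp_decompose] at this
  simpa using this

theorem update_vecCons_zero {r : ℕ} (x y : Fin n) (E : Fin r → Fin n) :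
    Function.update (Matrix.vecCons x E) 0 y = Matrix.vecCons y E := by
  funext j
  refine Fin.cases ?_ (fun j => ?_) j <;> simp

theorem update_vecCons_succ {r : ℕ} (x y : Fin n) (E : Fin r → Fin n) (i : Fin r) :
    Function.update (Matrix.vecCons x E) i.succ y = Matrix.vecCons x (Function.update E i y) := by
  funext j
  refine Fin.cases ?_ (fun j => ?_) j
  · simp [Function.update_of_ne (Fin.succ_ne_zero i).symm]
  · by_cases h : j = i
    · subst h; simp
    · simp [h]

theorem IsAlt.swap_two {r : ℕ} {T : (Fin (r + 2) → Fin n) → ℝ} (hT : IsAlt T) (x y : Fin n)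
    (E : Fin r → Fin n) :
    T (Matrix.vecCons x (Matrix.vecCons y E)) = - T (Matrix.vecCons y (Matrix.vecCons x E)) := by
  have := hT.vecCons_update x y (Matrix.vecCons y E) 0
  rwa [update_vecCons_zero, update_vecCons_zero] at this

theorem IsAlt.swap_one_update {r : ℕ} {T : (Fin (r + 2) → Fin n) → ℝ} (hT : IsAlt T)
    (x y z : Fin n) (E : Fin r → Fin n) (i : Fin r) :
    T (Matrix.vecCons x (Matrix.vecCons y (Function.update E i z)))
      = - T (Matrix.vecCons x (Matrix.vecCons z (Function.update E i y))) :=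
  (hT.vecCons x).vecCons_update y z E i

theorem sum_perm_succ {r : ℕ} (f : Equiv.Perm (Fin (r + 1)) → ℝ) :
    ∑ σ, f σ = ∑ p, ∑ e, f (Equiv.Perm.decomposeFin.symm (p, e)) := by
  rw [← Fintype.sum_prod_type']
  exact (Equiv.sum_comp Equiv.Perm.decomposeFin.symm f).symm

/-- Permutations are grouped by the index they send to slot 0. Since `h` is alternating, the r!
members of a group contribute equally, which reduces 1/(r+1)! to 1/(r+1). -/
theorem antisym_mul {r : ℕ} (u : Fin n → ℝ) {h : (Fin r → Fin n) → ℝ} (hh : IsAlt h)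
    (y : Fin n) (B : Fin r → Fin n) :
    antisym (fun J : Fin (r + 1) → Fin n => u (J 0) * h (fun j => J j.succ)) (Matrix.vecCons y B)
      = ((r : ℝ) + 1)⁻¹ * (u y * h B - ∑ i, u (B i) * h (Function.update B i y)) := by
  have key : ∀ (p : Fin (r + 1)) (e : Equiv.Perm (Fin r)),
      (fun j : Fin r => Matrix.vecCons y B (Equiv.Perm.decomposeFin.symm (p, e) j.succ))
        = (fun j => ((Matrix.vecCons y B) ∘ Equiv.swap 0 p) j.succ) ∘ e := by
    intro p e; funext j; simp
  unfold antisym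
  rw [sum_perm_succ]
  -- The sign of `e` occurs twice and disappears; what remains is the sign of the transposition of 0
  -- and `p`.
  have h1 : ∀ (p : Fin (r + 1)) (e : Equiv.Perm (Fin r)),
      ((Equiv.Perm.sign (Equiv.Perm.decomposeFin.symm (p, e)) : ℤ) : ℝ) *
        (u (Matrix.vecCons y B (Equiv.Perm.decomposeFin.symm (p, e) 0)) *
          h (fun j : Fin r => Matrix.vecCons y B (Equiv.Perm.decomposeFin.symm (p, e) j.succ)))
        = (if p = 0 then 1 else -1) * (u (Matrix.vecCons y B p) *
          h (fun j => ((Matrix.vecCons y B) ∘ Equiv.swap 0 p) j.succ)) := by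
    intro p e
    rw [key, hh]
    have h2 : ((Equiv.Perm.sign e : ℤ) : ℝ) * ((Equiv.Perm.sign e : ℤ) : ℝ) = 1 := by
      exact_mod_cast Int.units_coe_mul_self (Equiv.Perm.sign e)
    rw [Equiv.Perm.decomposeFin.symm_sign, Equiv.Perm.decomposeFin_symm_apply_zero]
    generalize u (Matrix.vecCons y B p) = t
    generalize h _ = q
    split_ifs <;> push_cast
    · linear_combination (t * q) * h2
    · linear_combination (-t * q) * h2
  simp_rw [h1]
  simp only [Finset.sum_const, Finset.card_univ, Fintype.card_perm, Fintype.card_fin, nsmul_eq_mul]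
  rw [← Finset.mul_sum, Fin.sum_univ_succ, ← mul_assoc]
  have h3 : (((r + 1).factorial : ℕ) : ℝ)⁻¹ * (r.factorial : ℝ) = ((r : ℝ) + 1)⁻¹ := by
    rw [Nat.factorial_succ]
    have : (r.factorial : ℝ) ≠ 0 := by exact_mod_cast r.factorial_ne_zero
    push_cast
    field_simp
  rw [h3]
  congr 1
  simp only [vecCons_comp_swap]
  simp [Fin.succ_ne_zero, sub_eq_add_neg]

theorem metricWedge_eq {m : ℕ} (G : Matrix (Fin n) (Fin n) ℝ) {h : (Fin m → Fin n) → ℝ}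
    (hh : IsAlt h) (x y : Fin n) (B : Fin m → Fin n) :
    metricWedge G h x y B
      = ((m : ℝ) + 1)⁻¹ * (G x y * h B - ∑ i, G x (B i) * h (Function.update B i y)) :=
  antisym_mul (fun j => G x j) hh y B

/-- `∑ᵢ g_{eᵢ w} S_{xy e₃ ⋯ z ⋯ e_p}`, the index `z` standing at the place of `eᵢ`. -/
def metricHat {k : ℕ} (G : Matrix (Fin n) (Fin n) ℝ) (S : Fin n → Fin n → (Fin k → Fin n) → ℝ)
    (E : Fin k → Fin n) (x y z w : Fin n) : ℝ :=
  ∑ i, G (E i) w * S x y (Function.update E i z)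

/-- The factor k cancels the 1/k of the antisymmetrization. As the bracket enters `intCond` only
with this factor, p = 2 needs no separate treatment later. -/
theorem bracketTerm_eq {k : ℕ} (G : Matrix (Fin n) (Fin n) ℝ)
    {S : Fin n → Fin n → (Fin k → Fin n) → ℝ} (hS : ∀ x y, IsAlt (S x y)) (x y z w : Fin n)
    (E : Fin k → Fin n) :
    (k : ℝ) * bracketTerm G S x y z w E = metricHat G S E x y z w := by
  cases k with
  | zero => simp [metricHat]
  | succ k =>
    have hE : E = Matrix.vecCons (E 0) (fun j => E j.succ) := by
      funext j; refine Fin.cases ?_ (fun j => ?_) j <;> simp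
    generalize hE0 : E 0 = e at hE
    generalize (fun j : Fin k => E j.succ) = F at hE
    subst hE
    have h1 := antisym_mul (fun j => G j w) ((hS x y).vecCons z) e F
    have h2 : bracketTerm G S x y z w (Matrix.vecCons e F)
        = antisym (fun J : Fin (k + 1) → Fin n => G (J 0) w *
          S x y (Matrix.vecCons z (fun j => J j.succ))) (Matrix.vecCons e F) := by
      simp only [bracketTerm, mul_comm]
    rw [h2, h1, metricHat, Fin.sum_univ_succ]
    simp only [update_vecCons_zero, update_vecCons_succ, Matrix.cons_val_zero,
      Matrix.cons_val_succ]
    simp_rw [(hS x y).vecCons_update z e F]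
    have : ((k : ℝ) + 1) ≠ 0 := by positivity
    simp only [mul_neg, Finset.sum_neg_distrib, sub_neg_eq_add]
    push_cast
    field_simp

theorem antisym₃_eq (T : Fin n → Fin n → Fin n → ℝ) (x y z : Fin n) :
    antisym₃ T x y z
      = (T x y z + T y z x + T z x y - T y x z - T x z y - T z y x) / 6 := by
  unfold antisym₃ antisym
  simp only [sum_perm_succ, Fin.sum_univ_succ, Finset.univ_unique, Finset.sum_singleton,
    Equiv.Perm.decomposeFin.symm_sign]
  have e1 : Equiv.Perm.decomposeFin.symm ((0 : Fin 3), Equiv.swap (0 : Fin 2) 1) 2 = 1 := by decide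
  have e2 : Equiv.Perm.decomposeFin.symm ((1 : Fin 3), Equiv.swap (0 : Fin 2) 1) 2 = 0 := by decide
  have e3 : Equiv.Perm.decomposeFin.symm ((2 : Fin 3), Equiv.swap (0 : Fin 2) 1) 2 = 1 := by decide
  have e4 : (Equiv.swap (0 : Fin 3) 1) 2 = 2 := by decide
  have e5 : (Equiv.swap (0 : Fin 3) 2) 1 = 1 := by decide
  simp [Nat.factorial, e1, e2, e3, e4, e5]
  ring

theorem IsAlt.add {r : ℕ} {S T : (Fin r → Fin n) → ℝ} (hS : IsAlt S) (hT : IsAlt T) :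
    IsAlt (fun I => S I + T I) := by
  intro σ I
  show S (I ∘ σ) + T (I ∘ σ) = _
  rw [hS, hT]; ring

theorem IsAlt.const_mul {r : ℕ} {T : (Fin r → Fin n) → ℝ} (hT : IsAlt T) (c : ℝ) :
    IsAlt (fun I => c * T I) := by
  intro σ I
  show c * T (I ∘ σ) = _
  rw [hT]; ring

theorem IsAlt.sum {r : ℕ} {ι : Type*} (s : Finset ι) {T : ι → (Fin r → Fin n) → ℝ}
    (hT : ∀ i ∈ s, IsAlt (T i)) : IsAlt (fun I => ∑ i ∈ s, T i I) := by
  intro σ I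
  show ∑ i ∈ s, T i (I ∘ σ) = _
  rw [Finset.mul_sum]
  exact Finset.sum_congr rfl fun i hi => hT i hi σ I

theorem update_comp_perm {r : ℕ} (I : Fin r → Fin n) (σ : Equiv.Perm (Fin r)) (i : Fin r)
    (f : Fin n) : Function.update (I ∘ σ) i f = (Function.update I (σ i) f) ∘ σ := by
  rw [Function.update_comp_eq_of_injective _ σ.injective]

theorem IsAlt.sum_update {r : ℕ} {T : (Fin r → Fin n) → ℝ} (hT : IsAlt T)
    (M : Fin n → Fin n → ℝ) :
    IsAlt (fun I => ∑ i, ∑ f, M f (I i) * T (Function.update I i f)) := by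
  intro σ I
  simp only [update_comp_perm, hT σ, Function.comp]
  rw [Equiv.sum_comp σ (fun i => ∑ f, M f (I i) *
    (((Equiv.Perm.sign σ : ℤ) : ℝ) * T (Function.update I i f)))]
  simp only [Finset.mul_sum]
  refine Finset.sum_congr rfl fun i _ => Finset.sum_congr rfl fun f _ => by ring

end Index

/-! ### Curvature symmetries and the two forms of the integrability condition. -/

/-- The algebraic symmetries of a Riemann tensor. -/
structure IsCurvature {n : ℕ} (K : Fin n → Fin n → Fin n → Fin n → ℝ) : Prop where
  anti_left : ∀ a b c d, K a b c d = - K b a c d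
  anti_right : ∀ a b c d, K a b c d = - K a b d c
  pair : ∀ a b c d, K a b c d = K c d a b
  bianchi : ∀ a b c d, K a b c d + K a c d b + K a d b c = 0

section Pointwise

variable {n k : ℕ} {G : Matrix (Fin n) (Fin n) ℝ} {K : Fin n → Fin n → Fin n → Fin n → ℝ}
  {Y : (Fin (k + 2) → Fin n) → ℝ}

theorem raise₁_anti (hK : IsCurvature K) (f x y z : Fin n) :
    raise₁ G K f x y z = - raise₁ G K f x z y := by
  simp only [raise₁, ← Finset.sum_neg_distrib]
  exact Finset.sum_congr rfl fun i _ => by rw [hK.anti_right]; ring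

theorem raise₁_bianchi (hK : IsCurvature K) (f x y z : Fin n) :
    raise₁ G K f x y z + raise₁ G K f y z x + raise₁ G K f z x y = 0 := by
  simp only [raise₁, ← Finset.sum_add_distrib]
  exact Finset.sum_eq_zero fun i _ => by linear_combination G⁻¹ f i * hK.bianchi i x y z

theorem curvForm_anti (hK : IsCurvature K) (x y z w : Fin n) (E : Fin k → Fin n) :
    curvForm G K Y x y z w E = - curvForm G K Y x z y w E := by
  simp only [curvForm, ← Finset.sum_neg_distrib]
  exact Finset.sum_congr rfl fun i _ => by rw [raise₁_anti hK]; ring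

theorem curvForm_bianchi (hK : IsCurvature K) (x y z w : Fin n) (E : Fin k → Fin n) :
    curvForm G K Y x y z w E + curvForm G K Y y z x w E + curvForm G K Y z x y w E = 0 := by
  simp only [curvForm, ← Finset.sum_add_distrib]
  exact Finset.sum_eq_zero fun f _ => by
    linear_combination Y (Matrix.vecCons w (Matrix.vecCons f E)) * raise₁_bianchi (G := G) hK f x y z

theorem curvFormHat_anti_left (hK : IsCurvature K) (x y z w : Fin n) (E : Fin k → Fin n) :
    curvFormHat G K Y E x y z w = - curvFormHat G K Y E y x z w := by
  simp only [curvFormHat, ← Finset.sum_neg_distrib]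
  exact Finset.sum_congr rfl fun i _ => Finset.sum_congr rfl fun f _ => by
    rw [raise₁_anti hK]; ring

theorem curvFormHat_anti_right (hY : IsAlt Y) (x y z w : Fin n) (E : Fin k → Fin n) :
    curvFormHat G K Y E x y z w = - curvFormHat G K Y E x y w z := by
  simp only [curvFormHat, ← Finset.sum_neg_distrib]
  exact Finset.sum_congr rfl fun i _ => Finset.sum_congr rfl fun f _ => by
    rw [hY.swap_two]; ring

/-- The action of the curvature on a `p`-form with indices `c d E`. -/
def curvAct (G : Matrix (Fin n) (Fin n) ℝ) (K : Fin n → Fin n → Fin n → Fin n → ℝ)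
    (Y : (Fin (k + 2) → Fin n) → ℝ) (a b c d : Fin n) (E : Fin k → Fin n) : ℝ :=
  curvForm G K Y c a b d E - curvForm G K Y d a b c E - curvFormHat G K Y E a b c d

/-- The integrability condition, symmetric in the first and third as well as in the second and
fourth index, obtained directly by differentiating the conformal Killing–Yano equation. -/
def symCond (G : Matrix (Fin n) (Fin n) ℝ) (K : Fin n → Fin n → Fin n → Fin n → ℝ)
    (Y : (Fin (k + 2) → Fin n) → ℝ) (S : Fin n → Fin n → (Fin k → Fin n) → ℝ)
    (a b c d : Fin n) (E : Fin k → Fin n) : ℝ :=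
  curvAct G K Y b a c d E + curvAct G K Y d a c b E
    - curvAct G K Y c b a d E - curvAct G K Y c d a b E
    + 2 / ((k : ℝ) + 2) *
      (G a b * S c d E + G a d * S b c E - 2 * G b d * S a c E - 2 * G a c * S b d E
        + G c d * S a b E + G b c * S a d E
        + metricHat G S E b d a c + metricHat G S E b d c a
        + metricHat G S E a c d b + metricHat G S E a c b d)

theorem metricHat_symm {S : Fin n → Fin n → (Fin k → Fin n) → ℝ}
    (hS : ∀ x y E, S x y E = S y x E) (E : Fin k → Fin n) (x y z w : Fin n) :
    metricHat G S E x y z w = metricHat G S E y x z w := by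
  simp only [metricHat, hS x y]

theorem intCond_eq {S : Fin n → Fin n → (Fin k → Fin n) → ℝ}
    (hS' : ∀ x y, IsAlt (S x y)) (a b c d : Fin n) (E : Fin k → Fin n) :
    intCond G K Y S a b c d E
      = curvForm G K Y a c b d E + curvForm G K Y b d a c E
        + curvForm G K Y c a d b E + curvForm G K Y d b c a E
        + antisym₃ (fun b c d => curvFormHat G K Y E b c d a) b c d
        + 2 * antisym₃ (fun b c d => curvFormHat G K Y E a b c d) b c d
        + 2 * curvFormHat G K Y E b c a d
        - 3 * antisym₃ (fun a b c => curvFormHat G K Y E a b c d) a b c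
        + 2 / ((k : ℝ) + 2) * (G a c * S b d E + G b d * S a c E - G a b * S c d E - G c d * S a b E
          + (metricHat G S E d c b a - metricHat G S E d b c a
            + metricHat G S E c d a b - metricHat G S E c a d b
            + metricHat G S E b a d c - metricHat G S E b d a c
            + metricHat G S E a b c d - metricHat G S E a c b d) / 3) := by
  unfold intCond
  simp only [← bracketTerm_eq G hS']
  have hk : (k : ℝ) + 2 ≠ 0 := by positivity
  field_simp
  ring

/-- The right side antisymmetrizes `symCond` in b and c. Once all index pairs are put in a fixed
order, the cyclic identity is the only further relation needed. -/
theorem three_mul_intCond (hG : ∀ i j, G i j = G j i) (hK : IsCurvature K) (hY : IsAlt Y)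
    {S : Fin n → Fin n → (Fin k → Fin n) → ℝ} (hS : ∀ x y E, S x y E = S y x E)
    (hS' : ∀ x y, IsAlt (S x y)) (a b c d : Fin n) (E : Fin k → Fin n) :
    3 * intCond G K Y S a b c d E = symCond G K Y S a c b d E - symCond G K Y S a b c d E := by
  rw [intCond_eq hS']
  unfold symCond curvAct
  simp only [antisym₃_eq]
  generalize 2 / ((k : ℝ) + 2) = q
  simp only [hG c b, hS c b, metricHat_symm hS E b a, metricHat_symm hS E c a,
    metricHat_symm hS E d b, metricHat_symm hS E d c]
  have l := fun x y z w => curvFormHat_anti_left (G := G) (Y := Y) hK x y z w E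
  have r := fun x y z w => curvFormHat_anti_right (G := G) (K := K) hY x y z w E
  simp only [l b a, l c a, l d a, l c b, l d b, l d c]
  simp only [r _ _ b a, r _ _ c a, r _ _ d a, r _ _ c b, r _ _ d b, r _ _ d c]
  have v := fun x y z w => curvForm_anti (G := G) (Y := Y) hK x y z w E
  have t := fun x y z w => curvForm_bianchi (G := G) (Y := Y) hK x y z w E
  -- One cyclic identity for each of the four indices that can stay on `Y`, outside the cycle.
  have t1 := t a b c d
  have t2 := t a b d c
  have t3 := t a c d b
  have t4 := t b c d a
  simp only [v _ b a, v _ c a, v _ d a, v _ c b, v _ d b] at t1 t2 t3 t4 ⊢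
  linarith

end Pointwise

/-! ### Metric traces and raised indices. -/

/-- The metric trace `g^{ac} F_{ac}`. -/
def contract {n : ℕ} (G : Matrix (Fin n) (Fin n) ℝ) (F : Fin n → Fin n → ℝ) : ℝ :=
  ∑ a, ∑ c, G⁻¹ a c * F a c

/-- Both indices of `F_{ac}` raised. -/
def raiseBoth {n : ℕ} (G : Matrix (Fin n) (Fin n) ℝ) (F : Fin n → Fin n → ℝ) (a c : Fin n) : ℝ :=
  ∑ a', ∑ c', G⁻¹ a a' * G⁻¹ c c' * F a' c'

section Contraction

variable {n : ℕ} {G : Matrix (Fin n) (Fin n) ℝ}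

theorem inv_symm (hG : ∀ i j, G i j = G j i) (i j : Fin n) : G⁻¹ i j = G⁻¹ j i := by
  have h : G.transpose = G := by ext i j; exact hG j i
  conv_lhs => rw [← h, ← Matrix.transpose_nonsing_inv]
  rfl

theorem sum_inv_mul (hdet : IsUnit G.det) (a b : Fin n) :
    ∑ c, G⁻¹ a c * G c b = if a = b then 1 else 0 := by
  rw [← Matrix.mul_apply, Matrix.nonsing_inv_mul G hdet, Matrix.one_apply]

theorem contract_add (F H : Fin n → Fin n → ℝ) :
    contract G (fun a c => F a c + H a c) = contract G F + contract G H := by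
  simp only [contract, mul_add, Finset.sum_add_distrib]

theorem contract_neg (F : Fin n → Fin n → ℝ) :
    contract G (fun a c => - F a c) = - contract G F := by
  simp only [contract, mul_neg, Finset.sum_neg_distrib]

theorem contract_sub (F H : Fin n → Fin n → ℝ) :
    contract G (fun a c => F a c - H a c) = contract G F - contract G H := by
  simp only [contract, mul_sub, Finset.sum_sub_distrib]

theorem contract_mul (F : Fin n → Fin n → ℝ) (r : ℝ) :
    contract G (fun a c => r * F a c) = r * contract G F := by
  simp only [contract, Finset.mul_sum]
  exact Finset.sum_congr rfl fun _ _ => Finset.sum_congr rfl fun _ _ => by ring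

theorem contract_sum {ι : Type*} (s : Finset ι) (F : ι → Fin n → Fin n → ℝ) :
    contract G (fun a c => ∑ i ∈ s, F i a c) = ∑ i ∈ s, contract G (F i) := by
  simp only [contract, Finset.mul_sum]
  exact (Finset.sum_congr rfl fun _ _ => Finset.sum_comm).trans Finset.sum_comm

theorem contract_swap (hG : ∀ i j, G i j = G j i) (F : Fin n → Fin n → ℝ) :
    contract G (fun a c => F c a) = contract G F := by
  simp only [contract]
  rw [Finset.sum_comm]
  exact Finset.sum_congr rfl fun _ _ => Finset.sum_congr rfl fun _ _ => by rw [inv_symm hG]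

theorem contract_metric_right (hdet : IsUnit G.det) (F : Fin n → ℝ) (b : Fin n) :
    contract G (fun a c => G c b * F a) = F b := by
  simp only [contract, ← mul_assoc, ← Finset.sum_mul, sum_inv_mul hdet]
  simp

theorem contract_metric_left (hG : ∀ i j, G i j = G j i) (hdet : IsUnit G.det) (F : Fin n → ℝ)
    (b : Fin n) : contract G (fun a c => G a b * F c) = F b := by
  rw [← contract_swap hG, contract_metric_right hdet]

theorem contract_metric (hG : ∀ i j, G i j = G j i) (hdet : IsUnit G.det) :
    contract G (fun a c => G a c) = n := by
  have h : ∀ a c, G⁻¹ a c * G a c = G⁻¹ a c * G c a := fun a c => by rw [hG]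
  refine (Finset.sum_congr rfl fun a _ =>
    (Finset.sum_congr rfl fun c _ => h a c).trans (sum_inv_mul hdet a a)).trans ?_
  simp

theorem raiseBoth_anti {F : Fin n → Fin n → ℝ} (hF : ∀ a c, F a c = - F c a) (a c : Fin n) :
    raiseBoth G F a c = - raiseBoth G F c a := by
  simp only [raiseBoth, ← Finset.sum_neg_distrib]
  rw [Finset.sum_comm]
  exact Finset.sum_congr rfl fun _ _ => Finset.sum_congr rfl fun _ _ => by rw [hF]; ring

theorem sum_comm_pairs {ι : Type*} [Fintype ι] (X : ι → ι → ι → ι → ℝ) :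
    ∑ a, ∑ f, ∑ a', ∑ f', X a f a' f' = ∑ a', ∑ f', ∑ a, ∑ f, X a f a' f' := by
  refine ((Finset.sum_congr rfl fun _ _ => Finset.sum_comm).trans Finset.sum_comm).trans ?_
  exact Finset.sum_congr rfl fun _ _ =>
    (Finset.sum_congr rfl fun _ _ => Finset.sum_comm).trans Finset.sum_comm

/-- Raising indices is self-adjoint for a symmetric metric, so raised indices can be moved from the
curvature onto the form, where antisymmetry is available. -/
theorem sum_raise_mul (hG : ∀ i j, G i j = G j i) (P F : Fin n → Fin n → ℝ) :
    ∑ a, ∑ f, raiseBoth G P a f * F a f = ∑ a, ∑ f, P a f * raiseBoth G F a f := by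
  simp only [raiseBoth, Finset.sum_mul, Finset.mul_sum]
  rw [sum_comm_pairs]
  refine Finset.sum_congr rfl fun a _ => Finset.sum_congr rfl fun f _ => Finset.sum_congr rfl
    fun a' _ => Finset.sum_congr rfl fun f' _ => ?_
  rw [inv_symm hG a, inv_symm hG f]; ring

theorem sum_mul_anti {P F : Fin n → Fin n → ℝ} (hP : ∀ a c, P a c = P c a)
    (hF : ∀ a c, F a c = - F c a) : ∑ a, ∑ c, P a c * F a c = 0 := by
  have : ∑ a, ∑ c, P a c * F a c = - ∑ a, ∑ c, P a c * F a c := by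
    conv_lhs => rw [Finset.sum_comm]
    simp only [← Finset.sum_neg_distrib]
    exact Finset.sum_congr rfl fun _ _ => Finset.sum_congr rfl fun _ _ => by rw [hP, hF]; ring
  linarith

theorem contract_raise (hG : ∀ i j, G i j = G j i) (P F : Fin n → Fin n → ℝ) :
    contract G (fun a c => ∑ f, (∑ f', G⁻¹ f f' * P f' a) * F c f)
      = ∑ a, ∑ f, P f a * raiseBoth G F a f := by
  simp only [contract, raiseBoth, Finset.sum_mul, Finset.mul_sum]
  refine Finset.sum_congr rfl fun a _ => ?_
  refine ((Finset.sum_congr rfl fun _ _ => Finset.sum_comm).trans Finset.sum_comm).trans ?_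
  refine Finset.sum_congr rfl fun f _ => Finset.sum_congr rfl
    fun a' _ => Finset.sum_congr rfl fun f' _ => ?_
  rw [inv_symm hG f]; ring

end Contraction

/-! ### Traces of the integrability condition and the formula for S. -/

section Trace

variable {n k : ℕ} {G : Matrix (Fin n) (Fin n) ℝ} {K : Fin n → Fin n → Fin n → Fin n → ℝ}
  {Y : (Fin (k + 2) → Fin n) → ℝ}

/-- Four terms return S once each and the trace of g gives -2n. In two hat terms the contracted
metric puts eᵢ back into its own slot, so each gives S once for every i. The total is 4 - 2n + 2k =
-2(n - p). -/
theorem contract_metricPart (hG : ∀ i j, G i j = G j i) (hdet : IsUnit G.det)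
    {S : Fin n → Fin n → (Fin k → Fin n) → ℝ} (hS : ∀ x y E, S x y E = S y x E)
    (b d : Fin n) (E : Fin k → Fin n) :
    contract G (fun a c => G a b * S c d E + G a d * S b c E - 2 * G b d * S a c E
        - 2 * G a c * S b d E + G c d * S a b E + G b c * S a d E
        + metricHat G S E b d a c + metricHat G S E b d c a
        + metricHat G S E a c d b + metricHat G S E a c b d)
      = (4 - 2 * n + 2 * k) * S b d E - 2 * G b d * contract G (fun a c => S a c E)
        + ∑ i, G (E i) b * contract G (fun a c => S a c (Function.update E i d))
        + ∑ i, G (E i) d * contract G (fun a c => S a c (Function.update E i b)) := by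
  have h1 : ∀ b d : Fin n, contract G (fun a c => metricHat G S E b d a c) = k * S b d E := by
    intro b d
    have : ∀ i : Fin k, contract G (fun a c => G (E i) c * S b d (Function.update E i a))
        = S b d E := by
      intro i
      simp only [hG (E i)]
      rw [contract_metric_right hdet (fun a => S b d (Function.update E i a))]
      simp
    simp only [metricHat, contract_sum, this]
    simp
  have h2 : ∀ b d : Fin n, contract G (fun a c => metricHat G S E a c d b)
      = ∑ i, G (E i) b * contract G (fun a c => S a c (Function.update E i d)) := by
    intro b d
    simp only [metricHat, contract_sum, contract_mul]
  have h3 : contract G (fun a c => metricHat G S E b d c a) = k * S b d E := by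
    rw [contract_swap hG, h1]
  have e1 : contract G (fun a c => G a b * S c d E) = S b d E :=
    contract_metric_left hG hdet (fun c => S c d E) b
  have e2 : contract G (fun a c => G a d * S b c E) = S b d E :=
    contract_metric_left hG hdet (fun c => S b c E) d
  have e3 : contract G (fun a c => G c d * S a b E) = S b d E := by
    rw [contract_metric_right hdet (fun c => S c b E) d, hS]
  have e4 : contract G (fun a c => G b c * S a d E) = S b d E := by
    simp only [hG b]
    exact contract_metric_right hdet (fun a => S a d E) b
  have e5 : contract G (fun a c => 2 * G a c * S b d E) = 2 * n * S b d E := by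
    have : ∀ a c, 2 * G a c * S b d E = (2 * S b d E) * G a c := fun a c => by ring
    simp only [this]
    rw [contract_mul (fun a c => G a c), contract_metric hG hdet]
    ring
  simp only [contract_add, contract_sub]
  rw [h1, h2, h2, h3, e1, e2, e3, e4, e5, contract_mul]
  ring

theorem raise₂_eq (a f c d : Fin n) :
    raise₂ G K a f c d = raiseBoth G (fun a' f' => K a' f' c d) a f := rfl

/-- `R^f_b Y_{dfE}`. -/
theorem contract_curvForm_ricci (hK : IsCurvature K)
    (b d : Fin n) (E : Fin k → Fin n) :
    contract G (fun a c => curvForm G K Y c b a d E)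
      = ∑ f, (∑ f', G⁻¹ f f' * ricci G K f' b) * Y (Matrix.vecCons d (Matrix.vecCons f E)) := by
  simp only [curvForm, raise₁, contract_sum, Finset.sum_mul, ricci]
  refine Finset.sum_congr rfl fun f _ => Finset.sum_congr rfl fun f' _ => ?_
  simp only [contract, Finset.mul_sum, Finset.sum_mul]
  refine Finset.sum_congr rfl fun a _ => Finset.sum_congr rfl fun c _ => ?_
  rw [hK.anti_left f' c b a, hK.anti_right c f' b a]
  ring

/-- By pair symmetry K_{fdba} + K_{fbda} is symmetric in f and a, while `Y` is antisymmetric in the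
indices it is contracted with. -/
theorem contract_curvForm_anti (hG : ∀ i j, G i j = G j i) (hK : IsCurvature K) (hY : IsAlt Y)
    (b d : Fin n) (E : Fin k → Fin n) :
    contract G (fun a c => curvForm G K Y d b a c E)
      + contract G (fun a c => curvForm G K Y b d a c E) = 0 := by
  simp only [curvForm, raise₁]
  rw [contract_raise hG (fun f a => K f d b a)
    (fun c f => Y (Matrix.vecCons c (Matrix.vecCons f E))),
    contract_raise hG (fun f a => K f b d a)
    (fun c f => Y (Matrix.vecCons c (Matrix.vecCons f E)))]
  simp only [← Finset.sum_add_distrib, ← add_mul]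
  refine sum_mul_anti (fun a f => ?_) (raiseBoth_anti fun a c => hY.swap_two a c E)
  rw [hK.pair f d b a, hK.pair f b d a, hK.anti_left b a f d, hK.anti_right a b f d,
    hK.anti_left d a f b, hK.anti_right a d f b]
  ring

/-- Only the part of K_{f eᵢ b a} antisymmetric in a and f meets `Y`; by the Bianchi identity it is
half of K_{a f eᵢ b}. The minus sign comes from exchanging the first two indices of `Y`. -/
theorem contract_curvFormHat (hG : ∀ i j, G i j = G j i) (hK : IsCurvature K) (hY : IsAlt Y)
    (b d : Fin n) (E : Fin k → Fin n) :
    contract G (fun a c => curvFormHat G K Y E b a c d)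
      = - (1 / 2) * ∑ i, ∑ a, ∑ f, raise₂ G K a f (E i) b *
          Y (Matrix.vecCons d (Matrix.vecCons a (Function.update E i f))) := by
  simp only [curvFormHat, raise₁]
  rw [contract_sum, Finset.mul_sum]
  refine Finset.sum_congr rfl fun i _ => ?_
  simp only [raise₂_eq]
  rw [contract_raise hG (fun f a => K f (E i) b a)
    (fun c f => Y (Matrix.vecCons c (Matrix.vecCons d (Function.update E i f)))),
    sum_raise_mul hG (fun a f => K a f (E i) b)
    (fun a f => Y (Matrix.vecCons d (Matrix.vecCons a (Function.update E i f))))]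
  set y : Fin n → Fin n → ℝ :=
    fun a f => Y (Matrix.vecCons d (Matrix.vecCons a (Function.update E i f))) with hy
  have hy' : (fun a f => Y (Matrix.vecCons a (Matrix.vecCons d (Function.update E i f))))
      = fun a f => - y a f := by
    funext a f; exact hY.swap_two _ _ _
  have hz : ∀ a f, raiseBoth G (fun a f => - y a f) a f = - raiseBoth G y a f := by
    intro a f
    simp only [raiseBoth, mul_neg, Finset.sum_neg_distrib]
  rw [hy']
  simp only [hz]
  -- The chosen combination is symmetric in a and f, which is the Bianchi identity in disguise.
  have key := sum_mul_anti (P := fun a f => 2 * K f (E i) b a - K a f (E i) b)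
    (F := raiseBoth G y) (fun a f => ?_)
    (raiseBoth_anti fun a f => hY.swap_one_update d a f E i)
  · simp only [sub_mul, mul_assoc, Finset.sum_sub_distrib, ← Finset.mul_sum] at key
    simp only [mul_neg, Finset.sum_neg_distrib]
    linarith
  · have b1 := hK.bianchi a (E i) b f
    have b2 := hK.bianchi f (E i) b a
    have p1 := hK.pair a b f (E i)
    have p2 := hK.pair f b a (E i)
    have q1 := hK.anti_right f (E i) a b
    have q2 := hK.anti_right a (E i) f b
    have q3 := hK.anti_left f a (E i) b
    linarith

theorem ricci_symm (hG : ∀ i j, G i j = G j i) (hK : IsCurvature K) (a b : Fin n) :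
    ricci G K a b = ricci G K b a := by
  simp only [ricci]
  rw [Finset.sum_comm]
  exact Finset.sum_congr rfl fun c _ => Finset.sum_congr rfl fun d _ => by
    rw [inv_symm hG, hK.pair]

theorem contract_sym₂ (hG : ∀ i j, G i j = G j i) (F : Fin n → Fin n → ℝ) :
    contract G (sym₂ F) = contract G F := by
  have : sym₂ F = fun a c => (1 / 2) * (F a c + F c a) := by
    funext a c; simp only [sym₂]; ring
  rw [this, contract_mul (fun a c => F a c + F c a), contract_add F (fun a c => F c a),
    contract_swap hG]
  ring

theorem contract_ricciForm (hG : ∀ i j, G i j = G j i) (hK : IsCurvature K) (hY : IsAlt Y)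
    (E : Fin k → Fin n) : contract G (fun c d => ricciForm G K Y c d E) = 0 := by
  refine (contract_sym₂ hG _).trans ?_
  rw [contract_raise hG (fun f a => ricci G K f a)
    (fun c f => Y (Matrix.vecCons c (Matrix.vecCons f E)))]
  exact sum_mul_anti (fun a f => ricci_symm hG hK f a) (raiseBoth_anti fun a c => hY.swap_two a c E)

/-- The full contraction pairs K_{a f eᵢ c} with a tensor totally antisymmetric in a, f, c. The
three cyclic versions are equal, and they sum to zero by the Bianchi identity. -/
theorem contract_curvFormTrace (hG : ∀ i j, G i j = G j i) (hK : IsCurvature K) (hY : IsAlt Y)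
    (E : Fin k → Fin n) : contract G (fun c d => curvFormTrace G K Y c d E) = 0 := by
  refine (contract_sym₂ hG _).trans ?_
  rw [contract_sum]
  refine Finset.sum_eq_zero fun i _ => ?_
  simp only [raise₂_eq]
  set y : Fin n → Fin n → Fin n → ℝ :=
    fun d a f => Y (Matrix.vecCons d (Matrix.vecCons a (Function.update E i f))) with hy
  have y1 : ∀ d a f, y d a f = - y d f a := fun d a f => hY.swap_one_update d a f E i
  have y2 : ∀ d a f, y d a f = - y a d f := fun d a f => hY.swap_two d a _
  have h1 : ∀ c d, ∑ a, ∑ f, raiseBoth G (fun a' f' => K a' f' (E i) c) a f * y d a f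
      = ∑ a, ∑ f, K a f (E i) c * raiseBoth G (y d) a f :=
    fun c d => sum_raise_mul hG (fun a f => K a f (E i) c) (y d)
  show contract G (fun c d => ∑ a, ∑ f,
    raiseBoth G (fun a' f' => K a' f' (E i) c) a f * y d a f) = 0
  simp only [h1]
  -- `z` is the form with c, a and f all raised; `z1` and `z2` give its total antisymmetry.
  set z : Fin n → Fin n → Fin n → ℝ := fun c a f => ∑ d, G⁻¹ c d * raiseBoth G (y d) a f with hz
  have z1 : ∀ c a f, z c a f = - z c f a := by
    intro c a f
    simp only [hz, ← Finset.sum_neg_distrib]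
    exact Finset.sum_congr rfl fun d _ => by rw [raiseBoth_anti (y1 d)]; ring
  have z2 : ∀ c a f, z c a f = - z a c f := by
    intro c a f
    simp only [hz, raiseBoth, ← Finset.sum_neg_distrib, Finset.mul_sum]
    rw [Finset.sum_comm]
    refine Finset.sum_congr rfl fun a' _ => Finset.sum_congr rfl fun d _ =>
      Finset.sum_congr rfl fun f' _ => ?_
    rw [y2]; ring
  have h2 : contract G (fun c d => ∑ a, ∑ f, K a f (E i) c * raiseBoth G (y d) a f)
      = ∑ c, ∑ a, ∑ f, K a f (E i) c * z c a f := by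
    simp only [contract, hz, Finset.mul_sum]
    refine Finset.sum_congr rfl fun c _ => ?_
    refine (Finset.sum_comm.trans (Finset.sum_congr rfl fun _ _ => Finset.sum_comm)).trans ?_
    exact Finset.sum_congr rfl fun _ _ => Finset.sum_congr rfl fun _ _ =>
      Finset.sum_congr rfl fun _ _ => by ring
  have r1 : ∑ c, ∑ a, ∑ f, K a f (E i) c * z c a f
      = ∑ c, ∑ a, ∑ f, K c a (E i) f * z c a f := by
    refine (Finset.sum_comm.trans (Finset.sum_congr rfl fun _ _ => Finset.sum_comm)).trans ?_
    exact Finset.sum_congr rfl fun a _ => Finset.sum_congr rfl fun f _ =>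
      Finset.sum_congr rfl fun c _ => by rw [z2 c a f, z1 a c f]; ring
  have r2 : ∑ c, ∑ a, ∑ f, K c a (E i) f * z c a f
      = ∑ c, ∑ a, ∑ f, K f c (E i) a * z c a f := by
    refine (Finset.sum_comm.trans (Finset.sum_congr rfl fun _ _ => Finset.sum_comm)).trans ?_
    exact Finset.sum_congr rfl fun a _ => Finset.sum_congr rfl fun f _ =>
      Finset.sum_congr rfl fun c _ => by rw [z2 c a f, z1 a c f]; ring
  have r3 : ∑ c, ∑ a, ∑ f, K a f (E i) c * z c a f + ∑ c, ∑ a, ∑ f, K c a (E i) f * z c a f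
      + ∑ c, ∑ a, ∑ f, K f c (E i) a * z c a f = 0 := by
    simp only [← Finset.sum_add_distrib]
    refine Finset.sum_eq_zero fun c _ => Finset.sum_eq_zero fun a _ =>
      Finset.sum_eq_zero fun f _ => ?_
    rw [hK.pair a f, hK.pair c a, hK.pair f c]
    linear_combination z c a f * hK.bianchi (E i) c a f
  rw [h2]
  linarith

theorem contract_curvAct (hG : ∀ i j, G i j = G j i) (hK : IsCurvature K) (hY : IsAlt Y)
    (b d : Fin n) (E : Fin k → Fin n) :
    contract G (fun a c => curvAct G K Y b a c d E + curvAct G K Y d a c b E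
        - curvAct G K Y c b a d E - curvAct G K Y c d a b E)
      = 4 * ricciForm G K Y b d E + 2 * curvFormTrace G K Y b d E := by
  have anti : ∀ a b c d : Fin n, curvAct G K Y a b c d E = - curvAct G K Y b a c d E := by
    intro a b c d
    simp only [curvAct]
    rw [curvForm_anti hK c, curvForm_anti hK d, curvFormHat_anti_left hK]
    ring
  have h1 : ∀ b d, contract G (fun a c => curvAct G K Y c b a d E)
      = - contract G (fun a c => curvAct G K Y b a c d E) := by
    intro b d
    rw [contract_swap hG (fun a c => curvAct G K Y a b c d E)]
    simp only [fun a => anti a b, contract_neg]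
  simp only [contract_add, contract_sub, h1]
  have h2 := contract_curvForm_anti hG hK hY b d E
  simp only [curvAct, contract_sub]
  rw [contract_curvForm_ricci hK, contract_curvForm_ricci hK, contract_curvFormHat hG hK hY,
    contract_curvFormHat hG hK hY]
  simp only [ricciForm, curvFormTrace, sym₂]
  linear_combination (-2) * h2

/-- The formula for `S`, obtained by taking the trace of the integrability condition. -/
theorem eq_riemannExpr_of_symCond (hG : ∀ i j, G i j = G j i) (hdet : IsUnit G.det)
    (hK : IsCurvature K) (hY : IsAlt Y) (hkn : k + 2 < n)
    {S : Fin n → Fin n → (Fin k → Fin n) → ℝ} (hS : ∀ x y E, S x y E = S y x E)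
    (h : ∀ a b c d E, symCond G K Y S a b c d E = 0) (c d : Fin n) (E : Fin k → Fin n) :
    S c d E = riemannExpr G K Y c d E := by
  have hkn' : (k : ℝ) + 2 < n := by exact_mod_cast hkn
  have hk : (k : ℝ) + 2 ≠ 0 := by positivity
  have tr : ∀ b d E, 4 * ricciForm G K Y b d E + 2 * curvFormTrace G K Y b d E
      + 2 / ((k : ℝ) + 2) * ((4 - 2 * n + 2 * k) * S b d E
        - 2 * G b d * contract G (fun a c => S a c E)
        + ∑ i, G (E i) b * contract G (fun a c => S a c (Function.update E i d))
        + ∑ i, G (E i) d * contract G (fun a c => S a c (Function.update E i b))) = 0 := by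
    intro b d E
    rw [← contract_curvAct hG hK hY, ← contract_metricPart hG hdet hS, ← contract_mul,
      ← contract_add]
    have : (fun a c => symCond G K Y S a b c d E) = fun _ _ => 0 := by
      funext a c; exact h a b c d E
    unfold symCond at this
    rw [this]
    simp [contract]
  -- Tracing `tr` once more, over b and d, isolates the trace of `S`, since the curvature terms are
  -- trace-free.
  have tr0 : ∀ E, contract G (fun a c => S a c E) = 0 := by
    intro E
    have h0 : contract G (fun b d => 4 * ricciForm G K Y b d E + 2 * curvFormTrace G K Y b d E
      + 2 / ((k : ℝ) + 2) * ((4 - 2 * n + 2 * k) * S b d E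
        - 2 * contract G (fun a c => S a c E) * G b d
        + ∑ i, G (E i) b * contract G (fun a c => S a c (Function.update E i d))
        + ∑ i, G (E i) d * contract G (fun a c => S a c (Function.update E i b)))) = 0 := by
      have : ∀ b d, 2 * contract G (fun a c => S a c E) * G b d
        = 2 * G b d * contract G (fun a c => S a c E) := fun b d => by ring
      simp only [this, tr]
      simp [contract]
    have e1 : contract G (fun b d => ∑ i, G (E i) d *
        contract G (fun a c => S a c (Function.update E i b)))
        = k * contract G (fun a c => S a c E) := by
      rw [contract_sum]
      have : ∀ i, contract G (fun b d => G (E i) d *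
          contract G (fun a c => S a c (Function.update E i b)))
          = contract G (fun a c => S a c E) := by
        intro i
        simp only [hG (E i)]
        rw [contract_metric_right hdet
          (fun b => contract G (fun a c => S a c (Function.update E i b)))]
        simp
      simp [this]
    have e2 : contract G (fun b d => ∑ i, G (E i) b *
        contract G (fun a c => S a c (Function.update E i d)))
        = k * contract G (fun a c => S a c E) := by
      rw [← e1, ← contract_swap hG]
    simp only [contract_add, contract_sub, contract_mul, e1, e2] at h0
    rw [contract_mul (fun a c => G a c), contract_metric hG hdet, contract_ricciForm hG hK hY,
      contract_curvFormTrace hG hK hY] at h0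
    -- The coefficient is (4 - 2n + 2k) - 2n + k + k = -4(n - p + 1), nonzero because p < n.
    have h1 : (4 - 4 * (n : ℝ) + 4 * k) * contract G (fun a c => S a c E) = 0 := by
      field_simp at h0
      linarith
    rcases mul_eq_zero.mp h1 with h1 | h1
    · linarith
    · exact h1
  have := tr c d E
  simp only [tr0, mul_zero, Finset.sum_const_zero, sub_zero, add_zero] at this
  unfold riemannExpr
  have hn : (n : ℝ) - ((k : ℝ) + 2) ≠ 0 := by linarith
  field_simp at this ⊢
  linarith

end Trace

/-! ### The Kulkarni–Nomizu product in the integrability condition. -/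

/-- The Kulkarni–Nomizu product of the metric with a symmetric tensor `P`. -/
def knProd {n : ℕ} (G : Matrix (Fin n) (Fin n) ℝ) (P : Fin n → Fin n → ℝ) (a b c d : Fin n) : ℝ :=
  G a c * P b d - G a d * P b c + G b d * P a c - G b c * P a d

/-- The Schouten tensor. -/
def schouten {n : ℕ} (G : Matrix (Fin n) (Fin n) ℝ) (K : Fin n → Fin n → Fin n → Fin n → ℝ)
    (a b : Fin n) : ℝ :=
  1 / ((n : ℝ) - 2) * (ricci G K a b - scalar G K / (2 * ((n : ℝ) - 1)) * G a b)

/-- `P^f_c`. -/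
def mixed {n : ℕ} (G : Matrix (Fin n) (Fin n) ℝ) (P : Fin n → Fin n → ℝ) (f c : Fin n) : ℝ :=
  ∑ f', G⁻¹ f f' * P f' c

/-- `P^f_c Y_{dfE}`. -/
def mixedForm {n k : ℕ} (G : Matrix (Fin n) (Fin n) ℝ) (P : Fin n → Fin n → ℝ)
    (Y : (Fin (k + 2) → Fin n) → ℝ) (c d : Fin n) (E : Fin k → Fin n) : ℝ :=
  ∑ f, mixed G P f c * Y (Matrix.vecCons d (Matrix.vecCons f E))

section KulkarniNomizu

variable {n k : ℕ} {G : Matrix (Fin n) (Fin n) ℝ} {K : Fin n → Fin n → Fin n → Fin n → ℝ}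
  {P : Fin n → Fin n → ℝ} {Y : (Fin (k + 2) → Fin n) → ℝ}

/-- The scalar term of `schouten` carries an extra factor 1/2 because `knProd G G` is twice
g_{ac}g_{bd} - g_{ad}g_{bc}. -/
theorem weyl_add_knProd (hn : 2 < n) (a b c d : Fin n) :
    K a b c d = weyl G K a b c d + knProd G (schouten G K) a b c d := by
  have hn' : (2 : ℝ) < n := by exact_mod_cast hn
  have h1 : (n : ℝ) - 1 ≠ 0 := by linarith
  have h2 : (n : ℝ) - 2 ≠ 0 := by linarith
  simp only [weyl, knProd, schouten]
  field_simp
  ring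

theorem raise₁_knProd (hdet : IsUnit G.det) (f a c b : Fin n) :
    raise₁ G (knProd G P) f a c b
      = (if f = c then P a b else 0) - (if f = b then P a c else 0)
        + G a b * mixed G P f c - G a c * mixed G P f b := by
  have h : ∀ f', G⁻¹ f f' * knProd G P f' a c b
      = G⁻¹ f f' * G f' c * P a b - G⁻¹ f f' * G f' b * P a c
        + G a b * (G⁻¹ f f' * P f' c) - G a c * (G⁻¹ f f' * P f' b) := by
    intro f'; simp only [knProd]; ring
  simp only [raise₁, h, Finset.sum_add_distrib, Finset.sum_sub_distrib, ← Finset.sum_mul,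
    sum_inv_mul hdet, ← Finset.mul_sum, mixed]
  simp only [ite_mul, one_mul, zero_mul]

theorem curvForm_knProd (hdet : IsUnit G.det) (x y z w : Fin n) (E : Fin k → Fin n) :
    curvForm G (knProd G P) Y x y z w E
      = P x z * Y (Matrix.vecCons w (Matrix.vecCons y E))
        - P x y * Y (Matrix.vecCons w (Matrix.vecCons z E))
        + G x z * mixedForm G P Y y w E - G x y * mixedForm G P Y z w E := by
  simp only [curvForm, raise₁_knProd hdet, sub_mul, add_mul, Finset.sum_add_distrib,
    Finset.sum_sub_distrib, mixedForm, Finset.mul_sum, ite_mul, zero_mul, mul_assoc]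
  simp

/-- `∑ᵢ P_{eᵢ y} Y_{zw e₃ ⋯ x ⋯ e_p}`. -/
def tensorHat (P : Fin n → Fin n → ℝ) (Y : (Fin (k + 2) → Fin n) → ℝ) (E : Fin k → Fin n)
    (y z w x : Fin n) : ℝ :=
  ∑ i, P (E i) y * Y (Matrix.vecCons z (Matrix.vecCons w (Function.update E i x)))

/-- `∑ᵢ g_{eᵢ y} P^f_x Y_{zw e₃ ⋯ f ⋯ e_p}`. -/
def mixedHat (G : Matrix (Fin n) (Fin n) ℝ) (P : Fin n → Fin n → ℝ)
    (Y : (Fin (k + 2) → Fin n) → ℝ) (E : Fin k → Fin n) (y x z w : Fin n) : ℝ :=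
  ∑ i, G (E i) y * ∑ f, mixed G P f x *
    Y (Matrix.vecCons z (Matrix.vecCons w (Function.update E i f)))

theorem curvFormHat_knProd (hdet : IsUnit G.det) (x y z w : Fin n) (E : Fin k → Fin n) :
    curvFormHat G (knProd G P) Y E x y z w
      = tensorHat P Y E y z w x - tensorHat P Y E x z w y
        + mixedHat G P Y E y x z w - mixedHat G P Y E x y z w := by
  simp only [curvFormHat, raise₁_knProd hdet, sub_mul, add_mul, Finset.sum_add_distrib,
    Finset.sum_sub_distrib, tensorHat, mixedHat, Finset.mul_sum, ite_mul, zero_mul, mul_assoc]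
  simp

theorem mixedHat_anti (hY : IsAlt Y) (E : Fin k → Fin n) (y x z w : Fin n) :
    mixedHat G P Y E y x z w = - mixedHat G P Y E y x w z := by
  simp only [mixedHat, ← Finset.sum_neg_distrib]
  refine Finset.sum_congr rfl fun i _ => ?_
  rw [← mul_neg, ← Finset.sum_neg_distrib]
  congr 1
  exact Finset.sum_congr rfl fun f _ => by rw [hY.swap_two]; ring

theorem tensorHat_anti (hY : IsAlt Y) (E : Fin k → Fin n) (y z w x : Fin n) :
    tensorHat P Y E y z w x = - tensorHat P Y E y w z x := by
  simp only [tensorHat, ← Finset.sum_neg_distrib]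
  exact Finset.sum_congr rfl fun i _ => by rw [hY.swap_two]; ring

theorem tensorHat_anti' (hY : IsAlt Y) (E : Fin k → Fin n) (y z w x : Fin n) :
    tensorHat P Y E y z w x = - tensorHat P Y E y z x w := by
  simp only [tensorHat, ← Finset.sum_neg_distrib]
  exact Finset.sum_congr rfl fun i _ => by rw [hY.swap_one_update]; ring

/-- `p P^f_{(c} Y_{d)fE}`. -/
def knForm (G : Matrix (Fin n) (Fin n) ℝ) (P : Fin n → Fin n → ℝ)
    (Y : (Fin (k + 2) → Fin n) → ℝ) (c d : Fin n) (E : Fin k → Fin n) : ℝ :=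
  ((k : ℝ) + 2) / 2 * (mixedForm G P Y c d E + mixedForm G P Y d c E)

/-- Exchanging `f` with the index placed in the slot of eᵢ turns the terms from `knForm` into the
`mixedHat` terms produced by the curvature, so that the two can be compared. -/
theorem metricHat_knForm (hY : IsAlt Y) (E : Fin k → Fin n) (x y z w : Fin n) :
    metricHat G (knForm G P Y) E x y z w
      = - (((k : ℝ) + 2) / 2) * (mixedHat G P Y E w x y z + mixedHat G P Y E w y x z) := by
  simp only [metricHat, knForm, mixedHat, mixedForm, ← Finset.sum_add_distrib, Finset.mul_sum]
  refine Finset.sum_congr rfl fun i _ => Finset.sum_congr rfl fun f _ => ?_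
  rw [hY.swap_one_update y f z, hY.swap_one_update x f z]
  ring

theorem mixedForm_isAlt (hY : IsAlt Y) (c d : Fin n) : IsAlt (mixedForm G P Y c d) :=
  IsAlt.sum _ fun f _ => ((hY.vecCons d).vecCons f).const_mul _

theorem knForm_isAlt (hY : IsAlt Y) (c d : Fin n) : IsAlt (knForm G P Y c d) :=
  ((mixedForm_isAlt hY c d).add (mixedForm_isAlt hY d c)).const_mul _

/-- The terms P·Y and `tensorHat` come from the curvature alone and cancel among themselves. Those
with g, namely g·`mixedForm` and `mixedHat`, cancel against the terms from `knForm`, whose factor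
p/2 absorbs the 2/p in `intCond`. -/
theorem intCond_knProd (hG : ∀ i j, G i j = G j i) (hdet : IsUnit G.det)
    (hP : ∀ i j, P i j = P j i) (hY : IsAlt Y) (a b c d : Fin n) (E : Fin k → Fin n) :
    intCond G (knProd G P) Y (knForm G P Y) a b c d E = 0 := by
  rw [intCond_eq (knForm_isAlt hY)]
  simp only [antisym₃_eq, curvForm_knProd hdet, curvFormHat_knProd hdet, metricHat_knForm hY]
  unfold knForm
  have hk : (k : ℝ) + 2 ≠ 0 := by positivity
  have y := fun u v => hY.swap_two u v E
  have u := fun u v w x => tensorHat_anti (P := P) hY E u v w x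
  have u' := fun u v w x => tensorHat_anti' (P := P) hY E u v w x
  have v := fun u v w x => mixedHat_anti (G := G) (P := P) hY E u v w x
  -- From here on every term is brought to a fixed order of a, b, c, d, after which the cancellation
  -- is linear.
  simp only [hG b a, hG c a, hG d b, hG d c, hP b a, hP c a, hP d b, hP d c, y b a, y c a, y d b,
    y d c]
  simp only [v _ _ b a, v _ _ c a, v _ _ d a, v _ _ c b, v _ _ d b, v _ _ d c]
  simp only [u _ b a, u _ c a, u _ d a, u _ c b, u _ d b, u _ d c]
  simp only [u' _ _ c a, u' _ _ d a, u' _ _ c b, u' _ _ d b, u' _ _ d c]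
  simp only [u _ b a, u _ c a, u _ c b]
  field_simp
  ring

end KulkarniNomizu

/-! ### Weyl–Schouten splitting and conformal weights of algebraic expressions. -/

section Weyl

variable {n k : ℕ} {G : Matrix (Fin n) (Fin n) ℝ} {K : Fin n → Fin n → Fin n → Fin n → ℝ}
  {P : Fin n → Fin n → ℝ} {Y : (Fin (k + 2) → Fin n) → ℝ}

theorem ricciForm_eq (c d : Fin n) (E : Fin k → Fin n) :
    ricciForm G K Y c d E
      = (mixedForm G (ricci G K) Y c d E + mixedForm G (ricci G K) Y d c E) / 2 := rfl

theorem schouten_symm (hG : ∀ i j, G i j = G j i) (hK : IsCurvature K) (a b : Fin n) :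
    schouten G K a b = schouten G K b a := by
  simp only [schouten, ricci_symm hG hK a b, hG a b]

theorem mixedForm_schouten (hdet : IsUnit G.det) (c d : Fin n) (E : Fin k → Fin n) :
    mixedForm G (schouten G K) Y c d E
      = 1 / ((n : ℝ) - 2) * (mixedForm G (ricci G K) Y c d E
          - scalar G K / (2 * ((n : ℝ) - 1)) * Y (Matrix.vecCons d (Matrix.vecCons c E))) := by
  have h1 : ∀ f, mixed G (schouten G K) f c = 1 / ((n : ℝ) - 2) * (mixed G (ricci G K) f c
      - scalar G K / (2 * ((n : ℝ) - 1)) * if f = c then 1 else 0) := by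
    intro f
    rw [← sum_inv_mul hdet f c]
    simp only [mixed, schouten, Finset.mul_sum, ← Finset.sum_sub_distrib]
    exact Finset.sum_congr rfl fun _ _ => by ring
  have h2 : Y (Matrix.vecCons d (Matrix.vecCons c E))
      = ∑ f, (if f = c then 1 else 0) * Y (Matrix.vecCons d (Matrix.vecCons f E)) := by
    simp
  rw [h2]
  simp only [mixedForm, h1, Finset.mul_sum, ← Finset.sum_sub_distrib]
  exact Finset.sum_congr rfl fun _ _ => by ring

/-- The scalar part of the Schouten tensor multiplies Y_{dcE}, which is antisymmetric in c and d and
drops out of the symmetrization. This is why Σ contains no scalar curvature. -/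
theorem knForm_schouten (hdet : IsUnit G.det) (hY : IsAlt Y) (c d : Fin n) (E : Fin k → Fin n) :
    knForm G (schouten G K) Y c d E
      = ((k : ℝ) + 2) / ((n : ℝ) - 2) * ricciForm G K Y c d E := by
  rw [knForm, ricciForm_eq, mixedForm_schouten hdet, mixedForm_schouten hdet, hY.swap_two d c]
  ring

theorem ricciWeylExpr_eq (hdet : IsUnit G.det) (hY : IsAlt Y) (c d : Fin n)
    (E : Fin k → Fin n) :
    ricciWeylExpr G K Y c d E = weylExpr G K Y c d E + knForm G (schouten G K) Y c d E := by
  rw [knForm_schouten hdet hY, ricciWeylExpr, add_comm]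

theorem curvFormTrace_isAlt (hY : IsAlt Y) (c d : Fin n) : IsAlt (curvFormTrace G K Y c d) := by
  have h : ∀ c d, IsAlt (fun E : Fin k → Fin n => ∑ i, ∑ a, ∑ f, raise₂ G K a f (E i) c *
      Y (Matrix.vecCons d (Matrix.vecCons a (Function.update E i f)))) := by
    intro c d
    have e : (fun E : Fin k → Fin n => ∑ i, ∑ a, ∑ f, raise₂ G K a f (E i) c *
        Y (Matrix.vecCons d (Matrix.vecCons a (Function.update E i f))))
        = fun E => ∑ a, ∑ i, ∑ f, raise₂ G K a f (E i) c *
        Y (Matrix.vecCons d (Matrix.vecCons a (Function.update E i f))) := by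
      funext E; exact Finset.sum_comm
    rw [e]
    exact IsAlt.sum _ fun a _ =>
      ((hY.vecCons d).vecCons a).sum_update (fun f e => raise₂ G K a f e c)
  have := ((h c d).add (h d c)).const_mul (1 / 2)
  convert this using 2
  simp only [curvFormTrace, sym₂]
  ring

theorem weylExpr_isAlt (hY : IsAlt Y) (c d : Fin n) : IsAlt (weylExpr G K Y c d) :=
  (curvFormTrace_isAlt hY c d).const_mul _

theorem intCond_add {K₁ K₂ : Fin n → Fin n → Fin n → Fin n → ℝ}
    {S₁ S₂ : Fin n → Fin n → (Fin k → Fin n) → ℝ} (h₁ : ∀ x y, IsAlt (S₁ x y))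
    (h₂ : ∀ x y, IsAlt (S₂ x y)) (a b c d : Fin n) (E : Fin k → Fin n) :
    intCond G (fun a b c d => K₁ a b c d + K₂ a b c d) Y (fun x y E => S₁ x y E + S₂ x y E)
        a b c d E
      = intCond G K₁ Y S₁ a b c d E + intCond G K₂ Y S₂ a b c d E := by
  rw [intCond_eq h₁, intCond_eq h₂, intCond_eq fun x y => (h₁ x y).add (h₂ x y)]
  have r : ∀ f x y z, raise₁ G (fun a b c d => K₁ a b c d + K₂ a b c d) f x y z
      = raise₁ G K₁ f x y z + raise₁ G K₂ f x y z := by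
    intro f x y z
    simp only [raise₁, mul_add, Finset.sum_add_distrib]
  have v : ∀ x y z w, curvForm G (fun a b c d => K₁ a b c d + K₂ a b c d) Y x y z w E
      = curvForm G K₁ Y x y z w E + curvForm G K₂ Y x y z w E := by
    intro x y z w
    simp only [curvForm, r, add_mul, Finset.sum_add_distrib]
  have u : ∀ x y z w, curvFormHat G (fun a b c d => K₁ a b c d + K₂ a b c d) Y E x y z w
      = curvFormHat G K₁ Y E x y z w + curvFormHat G K₂ Y E x y z w := by
    intro x y z w
    simp only [curvFormHat, r, add_mul, Finset.sum_add_distrib]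
  have m : ∀ x y z w, metricHat G (fun x y E => S₁ x y E + S₂ x y E) E x y z w
      = metricHat G S₁ E x y z w + metricHat G S₂ E x y z w := by
    intro x y z w
    simp only [metricHat, mul_add, Finset.sum_add_distrib]
  simp only [antisym₃_eq, v, u, m]
  ring

/-- Cancellation of the Ricci and scalar-curvature terms. -/
theorem intCond_ricciWeylExpr (hG : ∀ i j, G i j = G j i) (hdet : IsUnit G.det)
    (hK : IsCurvature K) (hY : IsAlt Y) (hn : 2 < n) (a b c d : Fin n) (E : Fin k → Fin n) :
    intCond G K Y (ricciWeylExpr G K Y) a b c d E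
      = intCond G (weyl G K) Y (weylExpr G K Y) a b c d E := by
  have h1 : K = fun a b c d => weyl G K a b c d + knProd G (schouten G K) a b c d := by
    funext a b c d; exact weyl_add_knProd hn a b c d
  have h2 : ricciWeylExpr G K Y
      = fun c d E => weylExpr G K Y c d E + knForm G (schouten G K) Y c d E := by
    funext c d E; exact ricciWeylExpr_eq hdet hY c d E
  have h3 := intCond_add (G := G) (K₁ := weyl G K) (K₂ := knProd G (schouten G K)) (Y := Y)
    (weylExpr_isAlt (G := G) (K := K) hY) (knForm_isAlt (G := G) (P := schouten G K) hY) a b c d E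
  rw [← h1, ← h2, intCond_knProd hG hdet (schouten_symm hG hK) hY, add_zero] at h3
  exact h3

theorem raise₂_knProd (hdet : IsUnit G.det) (a f e c : Fin n) :
    raise₂ G (knProd G P) a f e c
      = (if a = e then mixed G P f c else 0) - (if a = c then mixed G P f e else 0)
        + (if f = c then mixed G P a e else 0) - (if f = e then mixed G P a c else 0) := by
  have h : raise₂ G (knProd G P) a f e c = ∑ a', G⁻¹ a a' * - raise₁ G (knProd G P) f a' e c := by
    simp only [raise₂, raise₁, ← Finset.sum_neg_distrib, Finset.mul_sum]
    refine Finset.sum_congr rfl fun a' _ => Finset.sum_congr rfl fun f' _ => ?_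
    simp only [knProd]; ring
  have h2 : ∀ a', G⁻¹ a a' * - raise₁ G (knProd G P) f a' e c
      = G⁻¹ a a' * G a' e * mixed G P f c - G⁻¹ a a' * G a' c * mixed G P f e
        + (if f = c then 1 else 0) * (G⁻¹ a a' * P a' e)
        - (if f = e then 1 else 0) * (G⁻¹ a a' * P a' c) := by
    intro a'
    rw [raise₁_knProd hdet]
    split_ifs <;> ring
  simp only [h, h2, Finset.sum_add_distrib, Finset.sum_sub_distrib, ← Finset.sum_mul,
    sum_inv_mul hdet, ← Finset.mul_sum]
  simp only [mixed, ite_mul, one_mul, zero_mul]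

/-- For each i, the Kronecker deltas that tie a or f to eᵢ give -2 P^f_c Y_{dfE} in all. Those that
tie a or f to c give terms antisymmetric in c and d, removed by the symmetrization. -/
theorem curvFormTrace_knProd (hdet : IsUnit G.det) (hY : IsAlt Y)
    (c d : Fin n) (E : Fin k → Fin n) :
    curvFormTrace G (knProd G P) Y c d E
      = - k * (mixedForm G P Y c d E + mixedForm G P Y d c E) := by
  have h : ∀ c d, (∑ i, ∑ a, ∑ f, raise₂ G (knProd G P) a f (E i) c *
      Y (Matrix.vecCons d (Matrix.vecCons a (Function.update E i f))))
      = - 2 * k * mixedForm G P Y c d E - 2 * ∑ i, ∑ f, mixed G P f (E i) *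
        Y (Matrix.vecCons d (Matrix.vecCons c (Function.update E i f))) := by
    intro c d
    have hi : ∀ i, (∑ a, ∑ f, raise₂ G (knProd G P) a f (E i) c *
      Y (Matrix.vecCons d (Matrix.vecCons a (Function.update E i f))))
      = - 2 * mixedForm G P Y c d E - 2 * ∑ f, mixed G P f (E i) *
        Y (Matrix.vecCons d (Matrix.vecCons c (Function.update E i f))) := by
      intro i
      simp only [raise₂_knProd hdet, sub_mul, add_mul, Finset.sum_add_distrib,
        Finset.sum_sub_distrib, ite_mul, zero_mul]
      have s1 : ∀ f, Y (Matrix.vecCons d (Matrix.vecCons (E i) (Function.update E i f)))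
          = - Y (Matrix.vecCons d (Matrix.vecCons f E)) := by
        intro f
        rw [hY.swap_one_update]; simp
      have s2 : ∀ a, Y (Matrix.vecCons d (Matrix.vecCons a (Function.update E i c)))
          = - Y (Matrix.vecCons d (Matrix.vecCons c (Function.update E i a))) :=
        fun a => hY.swap_one_update d a c E i
      have t1 : ∀ (F : Fin n → Fin n → ℝ) e,
          (∑ a, ∑ f, if a = e then F a f else 0) = ∑ f, F e f := by
        intro F e; rw [Finset.sum_comm]; simp
      have t2 : ∀ (F : Fin n → Fin n → ℝ) e,
          (∑ a, ∑ f, if f = e then F a f else 0) = ∑ a, F a e := by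
        intro F e; simp
      let y : Fin n → Fin n → ℝ :=
        fun a f => Y (Matrix.vecCons d (Matrix.vecCons a (Function.update E i f)))
      rw [t1 (fun a f => mixed G P f c * y a f), t1 (fun a f => mixed G P f (E i) * y a f),
        t2 (fun a f => mixed G P a (E i) * y a f), t2 (fun a f => mixed G P a c * y a f)]
      simp only [y, s1, s2, Function.update_eq_self, mul_neg, Finset.sum_neg_distrib, mixedForm]
      ring
    simp only [hi, Finset.sum_sub_distrib, ← Finset.mul_sum]
    simp
    ring
  simp only [curvFormTrace, sym₂, h]
  have s : ∀ i f, Y (Matrix.vecCons d (Matrix.vecCons c (Function.update E i f)))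
      = - Y (Matrix.vecCons c (Matrix.vecCons d (Function.update E i f))) :=
    fun i f => hY.swap_two d c _
  simp only [s, mul_neg, Finset.sum_neg_distrib]
  ring

theorem curvFormTrace_add {K₁ K₂ : Fin n → Fin n → Fin n → Fin n → ℝ} (c d : Fin n)
    (E : Fin k → Fin n) :
    curvFormTrace G (fun a b c d => K₁ a b c d + K₂ a b c d) Y c d E
      = curvFormTrace G K₁ Y c d E + curvFormTrace G K₂ Y c d E := by
  simp only [curvFormTrace, sym₂, raise₂, mul_add, add_mul, Finset.sum_add_distrib]
  ring

theorem riemannExpr_eq_ricciWeylExpr (hdet : IsUnit G.det)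
    (hY : IsAlt Y) (hkn : k + 2 < n) (c d : Fin n) (E : Fin k → Fin n) :
    riemannExpr G K Y c d E = ricciWeylExpr G K Y c d E := by
  have hkn' : (k : ℝ) + 2 < n := by exact_mod_cast hkn
  have hk : (0 : ℝ) ≤ k := by positivity
  have h1 : K = fun a b c d => weyl G K a b c d + knProd G (schouten G K) a b c d := by
    funext a b c d; exact weyl_add_knProd (by omega) a b c d
  have h2 := curvFormTrace_add (G := G) (Y := Y) (K₁ := weyl G K) (K₂ := knProd G (schouten G K))
    c d E
  rw [← h1, curvFormTrace_knProd hdet hY] at h2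
  have h3 := knForm_schouten (K := K) hdet hY c d E
  rw [knForm] at h3
  have hn : (n : ℝ) - ((k : ℝ) + 2) ≠ 0 := by linarith
  have hn2 : (n : ℝ) - 2 ≠ 0 := by linarith
  unfold riemannExpr ricciWeylExpr weylExpr
  rw [h2]
  generalize mixedForm G (schouten G K) Y c d E + mixedForm G (schouten G K) Y d c E = m at h3 ⊢
  have h4 : m = 2 / ((n : ℝ) - 2) * ricciForm G K Y c d E := by
    field_simp at h3 ⊢
    linarith
  -- It remains to see that p/(n - p) · (1 - k/(n - 2)) = p/(n - 2), which holds because n - 2 - k =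
  -- n - p.
  rw [h4]
  field_simp
  ring

theorem ricci_knProd (hG : ∀ i j, G i j = G j i) (hdet : IsUnit G.det)
    (hP : ∀ i j, P i j = P j i) (a b : Fin n) :
    ricci G (knProd G P) a b = ((n : ℝ) - 2) * P a b + contract G P * G a b := by
  have e : ricci G (knProd G P) a b = contract G (fun c d => P a b * G c d - G d b * P a c
      + G a b * P c d - G c a * P b d) := by
    simp only [ricci, knProd, contract]
    refine Finset.sum_congr rfl fun c _ => Finset.sum_congr rfl fun d _ => ?_
    rw [hG d c, hG a c, hP d c, hP d b]
    ring
  rw [e]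
  simp only [contract_add, contract_sub]
  rw [contract_mul (fun c d => G c d), contract_metric hG hdet, contract_mul (fun c d => P c d),
    contract_metric_right hdet (fun c => P a c), contract_metric_left hG hdet (fun d => P b d), hP b a]
  ring

theorem inv_of_eq_smul (hdet : IsUnit G.det) {w : ℝ} (hw : w ≠ 0)
    {G' : Matrix (Fin n) (Fin n) ℝ} (hG' : G' = w • G) : G'⁻¹ = w⁻¹ • G⁻¹ := by
  have := Matrix.inv_smul' G (Units.mk0 w hw) hdet
  subst hG'
  simpa [Units.smul_def] using this

/-- Adding g ∧ P shifts Ricci by (n - 2)P + (tr P) g (`ricci_knProd`), and the trace terms in the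
Weyl tensor then remove exactly g ∧ P. Ricci itself acquires no factor: `w` meets one inverse
metric. -/
theorem weyl_conformal (hG : ∀ i j, G i j = G j i) (hdet : IsUnit G.det)
    (hP : ∀ i j, P i j = P j i) (hn : 2 < n) {w : ℝ} (hw : w ≠ 0)
    {G' : Matrix (Fin n) (Fin n) ℝ} (hG' : G' = w • G) {K' : Fin n → Fin n → Fin n → Fin n → ℝ}
    (hK' : ∀ a b c d, K' a b c d = w * (K a b c d + knProd G P a b c d)) (a b c d : Fin n) :
    weyl G' K' a b c d = w * weyl G K a b c d := by
  have hi := inv_of_eq_smul hdet hw hG'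
  have hr : ∀ a b, ricci G' K' a b
      = ricci G K a b + (((n : ℝ) - 2) * P a b + contract G P * G a b) := by
    intro a b
    rw [← ricci_knProd hG hdet hP]
    simp only [ricci, hi, hK', ← Finset.sum_add_distrib, Matrix.smul_apply, smul_eq_mul]
    refine Finset.sum_congr rfl fun c _ => Finset.sum_congr rfl fun d _ => ?_
    field_simp
  have hs : scalar G' K' = w⁻¹ * (scalar G K + 2 * ((n : ℝ) - 1) * contract G P) := by
    have e : scalar G' K' = w⁻¹ * contract G (fun a b => ricci G K a b
        + (((n : ℝ) - 2) * P a b + contract G P * G a b)) := by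
      simp only [scalar, hr, hi, contract, Finset.mul_sum, Matrix.smul_apply, smul_eq_mul]
      exact Finset.sum_congr rfl fun c _ => Finset.sum_congr rfl fun d _ => by ring
    rw [e]
    simp only [contract_add]
    rw [contract_mul (fun c d => G c d), contract_metric hG hdet, contract_mul (fun c d => P c d)]
    simp only [scalar, contract]
    ring
  have hn' : (2 : ℝ) < n := by exact_mod_cast hn
  have h1 : (n : ℝ) - 1 ≠ 0 := by linarith
  have h2 : (n : ℝ) - 2 ≠ 0 := by linarith
  simp only [weyl, hr, hs, hK', knProd]
  simp only [hG', Matrix.smul_apply, smul_eq_mul]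
  field_simp
  ring

/-- Two inverse metrics give w⁻², the lowered Weyl tensor w and the form r, hence the factor w⁻¹ r.
-/
theorem weylExpr_conformal (hdet : IsUnit G.det) {w r s : ℝ} (hw : w ≠ 0) (hrs : s = w⁻¹ * r)
    {G' : Matrix (Fin n) (Fin n) ℝ} (hG' : G' = w • G) {K' : Fin n → Fin n → Fin n → Fin n → ℝ}
    (hK' : ∀ a b c d, weyl G' K' a b c d = w * weyl G K a b c d)
    {Y' : (Fin (k + 2) → Fin n) → ℝ} (hY' : ∀ I, Y' I = r * Y I) (c d : Fin n)
    (E : Fin k → Fin n) :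
    weylExpr G' K' Y' c d E = s * weylExpr G K Y c d E := by
  have hi := inv_of_eq_smul hdet hw hG'
  have h2 : ∀ a f c d, raise₂ G' (weyl G' K') a f c d = w⁻¹ * raise₂ G (weyl G K) a f c d := by
    intro a f c d
    simp only [raise₂, hi, hK', Finset.mul_sum, Matrix.smul_apply, smul_eq_mul]
    refine Finset.sum_congr rfl fun c _ => Finset.sum_congr rfl fun d _ => ?_
    field_simp
  have h3 : ∀ c d, ∑ i, ∑ a, ∑ f, raise₂ G' (weyl G' K') a f (E i) c *
      Y' (Matrix.vecCons d (Matrix.vecCons a (Function.update E i f)))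
      = s * ∑ i, ∑ a, ∑ f, raise₂ G (weyl G K) a f (E i) c *
      Y (Matrix.vecCons d (Matrix.vecCons a (Function.update E i f))) := by
    intro c d
    simp only [h2, hY', hrs, Finset.mul_sum]
    exact Finset.sum_congr rfl fun c _ => Finset.sum_congr rfl fun d _ =>
      Finset.sum_congr rfl fun _ _ => by ring
  simp only [weylExpr, curvFormTrace, sym₂, h3]
  ring

end Weyl

/-! ### Metrics on coordinate domains and rules for partial derivatives. -/

/-- A smooth metric on an open subset of coordinate space. -/
structure IsMetricOn {n : ℕ} (g : EuclideanSpace ℝ (Fin n) → Matrix (Fin n) (Fin n) ℝ)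
    (U : Set (EuclideanSpace ℝ (Fin n))) : Prop where
  isOpen : IsOpen U
  symm : ∀ u ∈ U, ∀ i j, g u i j = g u j i
  isUnit_det : ∀ u ∈ U, IsUnit (g u).det
  smooth : ∀ u ∈ U, ∀ i j, ContDiffAt ℝ ∞ (fun v => g v i j) u

section PartialDerivatives

open Filter Topology

variable {n : ℕ} {u : EuclideanSpace ℝ (Fin n)} {f f' : EuclideanSpace ℝ (Fin n) → ℝ}

theorem pderiv_congr (a : Fin n) (h : f =ᶠ[𝓝 u] f') : pderiv a f u = pderiv a f' u := by
  simp only [pderiv, h.fderiv_eq]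

theorem pderiv_congr_on (a : Fin n) {U : Set (EuclideanSpace ℝ (Fin n))} (hU : IsOpen U)
    (hu : u ∈ U) (h : ∀ v ∈ U, f v = f' v) : pderiv a f u = pderiv a f' u :=
  pderiv_congr a (Filter.eventuallyEq_of_mem (hU.mem_nhds hu) h)

theorem pderiv_add (a : Fin n) (hf : ContDiffAt ℝ ∞ f u) (hf' : ContDiffAt ℝ ∞ f' u) :
    pderiv a (fun v => f v + f' v) u = pderiv a f u + pderiv a f' u := by
  simp only [pderiv]
  rw [fderiv_fun_add (hf.differentiableAt (by simp)) (hf'.differentiableAt (by simp))]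
  rfl

theorem pderiv_sub (a : Fin n) (hf : ContDiffAt ℝ ∞ f u) (hf' : ContDiffAt ℝ ∞ f' u) :
    pderiv a (fun v => f v - f' v) u = pderiv a f u - pderiv a f' u := by
  simp only [pderiv]
  rw [fderiv_fun_sub (hf.differentiableAt (by simp)) (hf'.differentiableAt (by simp))]
  rfl

theorem pderiv_mul (a : Fin n) (hf : ContDiffAt ℝ ∞ f u) (hf' : ContDiffAt ℝ ∞ f' u) :
    pderiv a (fun v => f v * f' v) u = pderiv a f u * f' u + f u * pderiv a f' u := by
  simp only [pderiv]
  rw [fderiv_fun_mul (hf.differentiableAt (by simp)) (hf'.differentiableAt (by simp))]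
  simp only [add_apply, smul_apply, smul_eq_mul]
  ring

theorem pderiv_const_mul (a : Fin n) (c : ℝ) (hf : ContDiffAt ℝ ∞ f u) :
    pderiv a (fun v => c * f v) u = c * pderiv a f u := by
  simp only [pderiv]
  rw [fderiv_const_mul (hf.differentiableAt (by simp))]
  rfl

theorem pderiv_sum (a : Fin n) {ι : Type*} (s : Finset ι)
    {F : ι → EuclideanSpace ℝ (Fin n) → ℝ} (hF : ∀ i ∈ s, ContDiffAt ℝ ∞ (F i) u) :
    pderiv a (fun v => ∑ i ∈ s, F i v) u = ∑ i ∈ s, pderiv a (F i) u := by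
  simp only [pderiv]
  rw [fderiv_fun_sum fun i hi => (hF i hi).differentiableAt (by simp)]
  simp

theorem contDiffAt_pderiv (a : Fin n) (hf : ContDiffAt ℝ ∞ f u) :
    ContDiffAt ℝ ∞ (fun v => pderiv a f v) u := by
  have : ContDiffAt ℝ ∞ (fderiv ℝ f) u := hf.fderiv_right (by simp)
  exact this.clm_apply contDiffAt_const

theorem two_le_smooth : (2 : WithTop ℕ∞) ≤ ∞ :=
  WithTop.coe_le_coe.mpr (le_top : (2 : ℕ∞) ≤ ⊤)

theorem pderiv_comm (a b : Fin n) (hf : ContDiffAt ℝ ∞ f u) :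
    pderiv a (fun v => pderiv b f v) u = pderiv b (fun v => pderiv a f v) u := by
  have h1 : ContDiffAt ℝ ∞ (fderiv ℝ f) u := hf.fderiv_right (by simp)
  have h2 : ∀ a b : Fin n, pderiv a (fun v => pderiv b f v) u
      = fderiv ℝ (fderiv ℝ f) u (EuclideanSpace.single a 1) (EuclideanSpace.single b 1) := by
    intro a b
    simp only [pderiv]
    rw [fderiv_clm_apply (h1.differentiableAt (by simp)) (differentiableAt_const _)]
    simp
  rw [h2, h2]
  exact (hf.isSymmSndFDerivAt (by simpa using two_le_smooth)) _ _

end PartialDerivatives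

/-! ### Christoffel symbols, the Riemann tensor and its conformal change. -/

section Curvature

variable {n : ℕ} {g : EuclideanSpace ℝ (Fin n) → Matrix (Fin n) (Fin n) ℝ}
  {U : Set (EuclideanSpace ℝ (Fin n))} {u : EuclideanSpace ℝ (Fin n)}

theorem contDiffAt_det {A : EuclideanSpace ℝ (Fin n) → Matrix (Fin n) (Fin n) ℝ}
    (hA : ∀ i j, ContDiffAt ℝ ∞ (fun v => A v i j) u) :
    ContDiffAt ℝ ∞ (fun v => (A v).det) u := by
  simp only [Matrix.det_apply']
  exact ContDiffAt.sum fun σ _ => contDiffAt_const.mul (contDiffAt_prod fun i _ => hA _ _)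

/-- By Cramer's rule the entries of the inverse are quotients of determinants. -/
theorem IsMetricOn.contDiffAt_inv (hg : IsMetricOn g U) (hu : u ∈ U) (i j : Fin n) :
    ContDiffAt ℝ ∞ (fun v => (g v)⁻¹ i j) u := by
  have h1 : ∀ v, (g v)⁻¹ i j = ((g v).det)⁻¹ * ((g v).updateRow j (Pi.single i 1)).det := by
    intro v
    rw [Matrix.inv_def, Matrix.smul_apply, Matrix.adjugate_apply, Ring.inverse_eq_inv', smul_eq_mul]
  simp only [h1]
  refine ((contDiffAt_det (hg.smooth u hu)).inv (hg.isUnit_det u hu).ne_zero).mul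
    (contDiffAt_det fun k l => ?_)
  by_cases hk : k = j
  · subst hk
    simp only [Matrix.updateRow_self]
    exact contDiffAt_const
  · simp only [Matrix.updateRow_ne hk]
    exact hg.smooth u hu k l

/-- The Christoffel symbols with all indices down. -/
def christoffelLow (g : EuclideanSpace ℝ (Fin n) → Matrix (Fin n) (Fin n) ℝ)
    (u : EuclideanSpace ℝ (Fin n)) (d a b : Fin n) : ℝ :=
  1 / 2 * (pderiv a (fun v => g v d b) u + pderiv b (fun v => g v d a) u
    - pderiv d (fun v => g v a b) u)

theorem christoffel_eq (c a b : Fin n) :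
    christoffel g u c a b = ∑ d, (g u)⁻¹ c d * christoffelLow g u d a b := by
  simp only [christoffel, christoffelLow, Finset.mul_sum]
  exact Finset.sum_congr rfl fun _ _ => by ring

theorem IsMetricOn.contDiffAt_christoffelLow (hg : IsMetricOn g U) (hu : u ∈ U) (d a b : Fin n) :
    ContDiffAt ℝ ∞ (fun v => christoffelLow g v d a b) u :=
  contDiffAt_const.mul (((contDiffAt_pderiv _ (hg.smooth u hu _ _)).add
    (contDiffAt_pderiv _ (hg.smooth u hu _ _))).sub (contDiffAt_pderiv _ (hg.smooth u hu _ _)))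

theorem IsMetricOn.contDiffAt_christoffel (hg : IsMetricOn g U) (hu : u ∈ U) (c a b : Fin n) :
    ContDiffAt ℝ ∞ (fun v => christoffel g v c a b) u := by
  simp only [christoffel_eq]
  exact ContDiffAt.sum fun d _ => (hg.contDiffAt_inv hu c d).mul
    (hg.contDiffAt_christoffelLow hu d a b)

theorem IsMetricOn.pderiv_symm (hg : IsMetricOn g U) (hu : u ∈ U) (a i j : Fin n) :
    pderiv a (fun v => g v i j) u = pderiv a (fun v => g v j i) u :=
  pderiv_congr_on a hg.isOpen hu fun v hv => hg.symm v hv i j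

theorem IsMetricOn.christoffelLow_symm (hg : IsMetricOn g U) (hu : u ∈ U) (d a b : Fin n) :
    christoffelLow g u d a b = christoffelLow g u d b a := by
  simp only [christoffelLow, hg.pderiv_symm hu d a b]
  ring

theorem IsMetricOn.christoffel_symm (hg : IsMetricOn g U) (hu : u ∈ U) (c a b : Fin n) :
    christoffel g u c a b = christoffel g u c b a := by
  simp only [christoffel_eq, hg.christoffelLow_symm hu _ a b]

theorem IsMetricOn.pderiv_metric (hg : IsMetricOn g U) (hu : u ∈ U) (a b c : Fin n) :
    pderiv a (fun v => g v b c) u = christoffelLow g u c a b + christoffelLow g u b a c := by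
  simp only [christoffelLow, hg.pderiv_symm hu _ c b, hg.pderiv_symm hu _ b a,
    hg.pderiv_symm hu _ c a]
  ring

theorem IsMetricOn.sum_christoffel_mul (hg : IsMetricOn g U) (hu : u ∈ U) (a b d : Fin n) :
    ∑ f, christoffel g u f a b * g u f d = christoffelLow g u d a b := by
  simp only [christoffel_eq, Finset.sum_mul]
  rw [Finset.sum_comm]
  have : ∀ e, ∑ f, (g u)⁻¹ f e * christoffelLow g u e a b * g u f d
      = christoffelLow g u e a b * if e = d then 1 else 0 := by
    intro e
    rw [← sum_inv_mul (hg.isUnit_det u hu), Finset.mul_sum]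
    exact Finset.sum_congr rfl fun f _ => by rw [inv_symm (hg.symm u hu)]; ring
  simp [this]

/-- The inner product `g^{fe} Γ_{f,ac} Γ_{e,bd}`. -/
def christoffelInner (g : EuclideanSpace ℝ (Fin n) → Matrix (Fin n) (Fin n) ℝ)
    (u : EuclideanSpace ℝ (Fin n)) (a c b d : Fin n) : ℝ :=
  contract (g u) (fun f e => christoffelLow g u f a c * christoffelLow g u e b d)

/-- The second partial derivatives `∂_a ∂_b g_{ij}` of the metric. -/
def metricHess (g : EuclideanSpace ℝ (Fin n) → Matrix (Fin n) (Fin n) ℝ)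
    (u : EuclideanSpace ℝ (Fin n)) (a b i j : Fin n) : ℝ :=
  pderiv a (fun v => pderiv b (fun v => g v i j) v) u

theorem IsMetricOn.pderiv_christoffelLow (hg : IsMetricOn g U) (hu : u ∈ U) (b d a c : Fin n) :
    pderiv b (fun v => christoffelLow g v d a c) u
      = 1 / 2 * (metricHess g u b a d c + metricHess g u b c d a - metricHess g u b d a c) := by
  have s := fun a i j => contDiffAt_pderiv a (hg.smooth u hu i j)
  simp only [christoffelLow]
  rw [pderiv_const_mul b _ (((s _ _ _).add (s _ _ _)).sub (s _ _ _)),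
    pderiv_sub b ((s _ _ _).add (s _ _ _)) (s _ _ _), pderiv_add b (s _ _ _) (s _ _ _)]
  rfl

theorem IsMetricOn.metricHess_comm (hg : IsMetricOn g U) (hu : u ∈ U) (a b i j : Fin n) :
    metricHess g u a b i j = metricHess g u b a i j :=
  pderiv_comm a b (hg.smooth u hu i j)

theorem IsMetricOn.metricHess_symm (hg : IsMetricOn g U) (hu : u ∈ U) (a b i j : Fin n) :
    metricHess g u a b i j = metricHess g u a b j i :=
  pderiv_congr_on a hg.isOpen hu fun _ hv => hg.pderiv_symm hv b i j

/-- With all indices down, the inverse metric enters only algebraically, through `christoffelInner`.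
Both the curvature symmetries and the conformal change are read off from this form. -/
theorem IsMetricOn.riemann_eq (hg : IsMetricOn g U) (hu : u ∈ U) (a b c d : Fin n) :
    riemann g u a b c d
      = 1 / 2 * (metricHess g u b c d a - metricHess g u b d a c - metricHess g u a c d b
          + metricHess g u a d b c)
        + (christoffelInner g u b c a d - christoffelInner g u a c b d) := by
  have s := hg.contDiffAt_christoffel hu
  -- The product rule applied to Γ^f_{ac} g_{fd} = Γ_{d,ac} gives the derivative of Γ^f without
  -- differentiating the inverse metric.
  have h1 : ∀ a b, ∑ f, pderiv b (fun v => christoffel g v f a c) u * g u f d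
      = pderiv b (fun v => christoffelLow g v d a c) u
        - ∑ f, christoffel g u f a c * (christoffelLow g u d b f + christoffelLow g u f b d) := by
    intro a b
    rw [← pderiv_congr_on b hg.isOpen hu fun _ hv => hg.sum_christoffel_mul hv a c d,
      pderiv_sum b _ fun f _ => (s f a c).mul (hg.smooth u hu f d)]
    simp only [pderiv_mul b (s _ a c) (hg.smooth u hu _ d), hg.pderiv_metric hu,
      Finset.sum_add_distrib, add_sub_cancel_right]
  have h2 : ∀ a b, ∑ f, (∑ e, christoffel g u e a c * christoffel g u f b e) * g u f d
      = ∑ e, christoffel g u e a c * christoffelLow g u d b e := by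
    intro a b
    simp only [Finset.sum_mul]
    rw [Finset.sum_comm]
    refine Finset.sum_congr rfl fun e _ => ?_
    rw [← hg.sum_christoffel_mul hu, Finset.mul_sum]
    exact Finset.sum_congr rfl fun f _ => by ring
  have h3 : ∀ a b, ∑ f, christoffel g u f a c * christoffelLow g u f b d
      = christoffelInner g u a c b d := by
    intro a b
    simp only [christoffel_eq, christoffelInner, contract, Finset.sum_mul]
    rw [Finset.sum_comm]
    exact Finset.sum_congr rfl fun e _ => Finset.sum_congr rfl fun f _ => by
      rw [inv_symm (hg.symm u hu)]; ring
  have h4 : riemann g u a b c d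
      = ∑ f, pderiv b (fun v => christoffel g v f a c) u * g u f d
        - ∑ f, pderiv a (fun v => christoffel g v f b c) u * g u f d
        + (∑ f, (∑ e, christoffel g u e a c * christoffel g u f b e) * g u f d
        - ∑ f, (∑ e, christoffel g u e b c * christoffel g u f a e) * g u f d) := by
    simp only [riemann, riemannMixed, ← Finset.sum_add_distrib, ← Finset.sum_sub_distrib]
    refine Finset.sum_congr rfl fun f _ => ?_
    rw [Finset.sum_sub_distrib]
    ring
  rw [h4, h1, h1, h2, h2, hg.pderiv_christoffelLow hu, hg.pderiv_christoffelLow hu]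
  simp only [mul_add, Finset.sum_add_distrib, h3, hg.metricHess_comm hu b a]
  ring

theorem IsMetricOn.christoffelInner_comm (hg : IsMetricOn g U) (hu : u ∈ U) (a c b d : Fin n) :
    christoffelInner g u a c b d = christoffelInner g u b d a c := by
  simp only [christoffelInner]
  rw [← contract_swap (hg.symm u hu)]
  simp only [mul_comm]

/-- Each symmetry reduces to the commutation of second partials, the symmetry of g, and the
symmetries of `christoffelInner`. -/
theorem IsMetricOn.isCurvature (hg : IsMetricOn g U) (hu : u ∈ U) :
    IsCurvature (riemann g u) := by
  have q := hg.metricHess_comm hu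
  have s := hg.metricHess_symm hu
  have i := hg.christoffelInner_comm hu
  have l : ∀ a c b d, christoffelInner g u a c b d = christoffelInner g u c a b d := by
    intro a c b d
    simp only [christoffelInner, hg.christoffelLow_symm hu _ a c]
  have r : ∀ a c b d, christoffelInner g u a c b d = christoffelInner g u a c d b := by
    intro a c b d
    simp only [christoffelInner, hg.christoffelLow_symm hu _ b d]
  refine ⟨fun a b c d => ?_, fun a b c d => ?_, fun a b p d => ?_, fun a b c d => ?_⟩ <;>
    simp only [hg.riemann_eq hu]
  · rw [s b c d a, s b d a c, s a c d b, s a d b c, s b c a d, s b d c a]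
    rw [s a c b d]
    ring
  · rw [i a d b c, s b c d a, s a d b c, s b d a c, s a c d b, i b d a c]
    ring
  · linarith [q b p d a, q b d a p, s d b a p, q a p d b, s p a d b, q a d b p,
      i b p a d, l a d b p, r d a b p, l a p b d, r p a b d]
  · linarith [q b c d a, s c b d a, q b d a c, s d b a c, q c d b a, s d c b a,
      i b c a d, r a d b c, i a c b d, l b d a c, i c d a b, r a b c d]

/-- The tensor `L` in `K' = w (K + g ∧ L)` for the conformal change `g' = w g`. -/
def conformalTensor (g : EuclideanSpace ℝ (Fin n) → Matrix (Fin n) (Fin n) ℝ)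
    (w : EuclideanSpace ℝ (Fin n) → ℝ) (u : EuclideanSpace ℝ (Fin n)) (b d : Fin n) : ℝ :=
  - 1 / (2 * w u) * (pderiv b (fun v => pderiv d w v) u
      - contract (g u) (fun f e => christoffelLow g u f b d * pderiv e w u))
    + 3 / (4 * w u ^ 2) * (pderiv b w u * pderiv d w u)
    - 1 / (8 * w u ^ 2) * contract (g u) (fun f e => pderiv f w u * pderiv e w u) * g u b d

theorem IsMetricOn.conformalTensor_symm (hg : IsMetricOn g U) (hu : u ∈ U)
    {w : EuclideanSpace ℝ (Fin n) → ℝ} (hw : ContDiffAt ℝ ∞ w u) (b d : Fin n) :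
    conformalTensor g w u b d = conformalTensor g w u d b := by
  simp only [conformalTensor, hg.christoffelLow_symm hu _ b d, hg.symm u hu b d,
    pderiv_comm b d hw]
  ring

/-- Up to a factor 1/2, the bracket is the correction to the lowered Christoffel symbol under g ↦ w
g; this evaluates its inner products with other terms. -/
theorem contract_rotation (hg : IsMetricOn g U) (hu : u ∈ U) (F w : Fin n → ℝ) (a d : Fin n) :
    contract (g u) (fun f e => F f * (w a * g u e d + w d * g u e a - w e * g u a d))
      = w a * F d + w d * F a - g u a d * contract (g u) (fun f e => F f * w e) := by
  have h : ∀ f e, F f * (w a * g u e d + w d * g u e a - w e * g u a d)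
      = w a * (g u e d * F f) + w d * (g u e a * F f) - g u a d * (F f * w e) := by
    intro f e; ring
  have hdet := hg.isUnit_det u hu
  simp only [h, contract_add, contract_sub]
  rw [contract_mul (fun f e => g u e d * F f), contract_mul (fun f e => g u e a * F f),
    contract_mul (fun f e => F f * w e), contract_metric_right hdet, contract_metric_right hdet]

/-- For w = e^{2φ}, `conformalTensor` is the classical -∇∇φ + dφ ⊗ dφ - ½|dφ|² g. Working with w
itself avoids logarithms. -/
theorem IsMetricOn.riemann_conformal (hg : IsMetricOn g U) (hu : u ∈ U)
    {g' : EuclideanSpace ℝ (Fin n) → Matrix (Fin n) (Fin n) ℝ} (hg' : IsMetricOn g' U)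
    {w : EuclideanSpace ℝ (Fin n) → ℝ} (hw : ∀ v ∈ U, ContDiffAt ℝ ∞ w v)
    (hw0 : ∀ v ∈ U, w v ≠ 0) (h : ∀ v ∈ U, g' v = w v • g v) (a b c d : Fin n) :
    riemann g' u a b c d
      = w u * (riemann g u a b c d + knProd (g u) (conformalTensor g w u) a b c d) := by
  have p1 : ∀ v ∈ U, ∀ a i j, pderiv a (fun v => g' v i j) v
      = pderiv a w v * g v i j + w v * pderiv a (fun v => g v i j) v := by
    intro v hv a i j
    rw [← pderiv_mul a (hw v hv) (hg.smooth v hv i j)]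
    exact pderiv_congr_on a hg.isOpen hv fun z hz => by rw [h z hz]; rfl
  have p2 : ∀ a b i j, metricHess g' u a b i j
      = pderiv a (fun v => pderiv b w v) u * g u i j
        + pderiv b w u * pderiv a (fun v => g v i j) u
        + pderiv a w u * pderiv b (fun v => g v i j) u + w u * metricHess g u a b i j := by
    intro a b i j
    have s1 := contDiffAt_pderiv b (hw u hu)
    have s2 := contDiffAt_pderiv b (hg.smooth u hu i j)
    rw [metricHess, pderiv_congr_on a hg.isOpen hu fun v hv => p1 v hv b i j,
      pderiv_add a (s1.mul (hg.smooth u hu i j)) ((hw u hu).mul s2),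
      pderiv_mul a s1 (hg.smooth u hu i j), pderiv_mul a (hw u hu) s2, metricHess]
    ring
  have l : ∀ f a c, christoffelLow g' u f a c = w u * christoffelLow g u f a c
      + 1 / 2 * (pderiv a w u * g u f c + pderiv c w u * g u f a - pderiv f w u * g u a c) := by
    intro f a c
    simp only [christoffelLow, p1 u hu]
    ring
  have hi := inv_of_eq_smul (hg.isUnit_det u hu) (hw0 u hu) (h u hu)
  have hc : ∀ F, contract (g' u) F = (w u)⁻¹ * contract (g u) F := by
    intro F
    simp only [contract, hi, Finset.mul_sum, Matrix.smul_apply, smul_eq_mul]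
    exact Finset.sum_congr rfl fun _ _ => Finset.sum_congr rfl fun _ _ => by ring
  have hsym := hg.symm u hu
  set W := fun a => pderiv a w u with hW
  -- Bilinear expansion of the inner product: the old term, two cross terms, and the square of the
  -- correction.
  have t1 : ∀ b c a d, christoffelInner g' u b c a d
      = (w u)⁻¹ * (w u ^ 2 * christoffelInner g u b c a d
        + w u / 2 * (W a * christoffelLow g u d b c + W d * christoffelLow g u a b c
          - g u a d * contract (g u) (fun f e => christoffelLow g u f b c * W e))
        + w u / 2 * (W b * christoffelLow g u c a d + W c * christoffelLow g u b a d
          - g u b c * contract (g u) (fun f e => christoffelLow g u f a d * W e))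
        + 1 / 4 * (W a * (W b * g u d c + W c * g u d b - W d * g u b c)
          + W d * (W b * g u a c + W c * g u a b - W a * g u b c)
          - g u a d * (W b * W c + W c * W b - g u b c *
            contract (g u) (fun f e => W f * W e)))) := by
    intro b c a d
    have r1 := contract_rotation hg hu (fun f => christoffelLow g u f b c) W a d
    have r2 := contract_rotation hg hu (fun f => christoffelLow g u f a d) W b c
    have r3 := contract_rotation hg hu
      (fun f => W b * g u f c + W c * g u f b - W f * g u b c) W a d
    have r4 := contract_rotation hg hu W W b c
    rw [← contract_swap hsym] at r2 r4
    have r4' : contract (g u) (fun f e => (W b * g u f c + W c * g u f b - W f * g u b c) * W e)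
        = W b * W c + W c * W b - g u b c * contract (g u) (fun f e => W f * W e) := by
      rw [← r4]
      congr 1; funext f e; ring
    rw [r4'] at r3
    rw [← r1, ← r2, ← r3, christoffelInner, hc, christoffelInner]
    congr 1
    rw [← contract_mul, ← contract_mul, ← contract_mul, ← contract_mul, ← contract_add,
      ← contract_add, ← contract_add]
    congr 1
    funext f e
    rw [l, l]
    ring
  have m : ∀ a i j, pderiv a (fun v => g v i j) u
    = christoffelLow g u j a i + christoffelLow g u i a j := hg.pderiv_metric hu
  have gs := hg.christoffelLow_symm hu
  have hw0' := hw0 u hu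
  rw [hg'.riemann_eq hu, hg.riemann_eq hu]
  simp only [p2, t1, knProd, conformalTensor, m]
  simp only [hsym b a, hsym d a, hsym d b, hsym d c, gs _ b a, gs _ c a, gs _ d a, gs _ c b,
    gs _ d b, gs _ d c]
  simp only [hW]
  field_simp
  ring

end Curvature

/-! ### The covariant derivative and the Ricci identity. -/

/-- The covariant derivative as a tensor, the new index standing in front. -/
def nabla {n r : ℕ} (g : EuclideanSpace ℝ (Fin n) → Matrix (Fin n) (Fin n) ℝ)
    (T : EuclideanSpace ℝ (Fin n) → (Fin r → Fin n) → ℝ) (u : EuclideanSpace ℝ (Fin n))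
    (J : Fin (r + 1) → Fin n) : ℝ :=
  covDeriv g T u (J 0) (fun j => J j.succ)

/-- The derivation action of a matrix on covariant tensors. -/
def derAct {n r : ℕ} (M : Fin n → Fin n → ℝ) (T : (Fin r → Fin n) → ℝ) (I : Fin r → Fin n) : ℝ :=
  ∑ i, ∑ f, M f (I i) * T (Function.update I i f)

/-- Smoothness of the components of a tensor field on a set. -/
def IsSmoothOn {n r : ℕ} (T : EuclideanSpace ℝ (Fin n) → (Fin r → Fin n) → ℝ)
    (U : Set (EuclideanSpace ℝ (Fin n))) : Prop :=
  ∀ u ∈ U, ∀ I, ContDiffAt ℝ ∞ (fun v => T v I) u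

section CovariantDerivative

variable {n r : ℕ} {g : EuclideanSpace ℝ (Fin n) → Matrix (Fin n) (Fin n) ℝ}
  {U : Set (EuclideanSpace ℝ (Fin n))} {u : EuclideanSpace ℝ (Fin n)}
  {T T' : EuclideanSpace ℝ (Fin n) → (Fin r → Fin n) → ℝ}

theorem covDeriv_eq (a : Fin n) (I : Fin r → Fin n) :
    covDeriv g T u a I
      = pderiv a (fun v => T v I) u - derAct (fun f c => christoffel g u f a c) (T u) I := rfl

/-- When the two matrices act on different slots their order is immaterial and the terms cancel;
acting on the same slot they compose, leaving the commutator. -/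
theorem derAct_derAct (M N : Fin n → Fin n → ℝ) (T : (Fin r → Fin n) → ℝ) (I : Fin r → Fin n) :
    derAct M (derAct N T) I - derAct N (derAct M T) I
      = derAct (fun h c => ∑ f, (M f c * N h f - N f c * M h f)) T I := by
  have key : ∀ M N : Fin n → Fin n → ℝ, derAct M (derAct N T) I
      = derAct (fun h c => ∑ f, M f c * N h f) T I
        + ∑ i, ∑ j, if j = i then 0 else ∑ f, ∑ h, M f (I i) * N h (I j) *
          T (Function.update (Function.update I i f) j h) := by
    intro M N
    simp only [derAct]
    rw [← Finset.sum_add_distrib]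
    refine Finset.sum_congr rfl fun i _ => ?_
    have h1 : ∀ f, ∑ j, ∑ h, N h (Function.update I i f j) *
        T (Function.update (Function.update I i f) j h)
        = ∑ h, N h f * T (Function.update I i h) + ∑ j, if j = i then 0 else ∑ h, N h (I j) *
          T (Function.update (Function.update I i f) j h) := by
      intro f
      rw [← Finset.add_sum_erase _ _ (Finset.mem_univ i)]
      congr 1
      · simp
      · rw [← Finset.add_sum_erase Finset.univ (fun j => if j = i then 0 else _)
          (Finset.mem_univ i), if_pos rfl, zero_add]
        refine Finset.sum_congr rfl fun j hj => ?_
        have hj' : j ≠ i := Finset.ne_of_mem_erase hj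
        rw [if_neg hj', Function.update_of_ne hj']
    simp only [h1, mul_add, Finset.sum_add_distrib]
    congr 1
    · simp only [Finset.mul_sum, Finset.sum_mul]
      rw [Finset.sum_comm]
      exact Finset.sum_congr rfl fun _ _ => Finset.sum_congr rfl fun _ _ => by ring
    · simp only [Finset.mul_sum]
      rw [Finset.sum_comm]
      refine Finset.sum_congr rfl fun j _ => ?_
      split_ifs
      · simp
      · simp only [Finset.mul_sum, mul_assoc]
  rw [key M N, key N M]
  have hs : (∑ i, ∑ j, if j = i then 0 else ∑ f, ∑ h, M f (I i) * N h (I j) *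
        T (Function.update (Function.update I i f) j h))
      = ∑ i, ∑ j, if j = i then 0 else ∑ f, ∑ h, N f (I i) * M h (I j) *
        T (Function.update (Function.update I i f) j h) := by
    rw [Finset.sum_comm]
    refine Finset.sum_congr rfl fun i _ => Finset.sum_congr rfl fun j _ => ?_
    by_cases h : i = j
    · simp [h]
    · rw [if_neg h, if_neg (Ne.symm h), Finset.sum_comm]
      refine Finset.sum_congr rfl fun _ _ => Finset.sum_congr rfl fun _ _ => ?_
      rw [Function.update_comm h]
      ring
  rw [hs]
  simp only [derAct, Finset.sum_sub_distrib, sub_mul]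
  ring

theorem covDeriv_congr (hU : IsOpen U) (hu : u ∈ U) (h : ∀ v ∈ U, T v = T' v) (a : Fin n)
    (I : Fin r → Fin n) : covDeriv g T u a I = covDeriv g T' u a I := by
  simp only [covDeriv_eq, h u hu]
  rw [pderiv_congr_on a hU hu fun v hv => congrFun (h v hv) I]

theorem covDeriv_add (hu : u ∈ U) (hT : IsSmoothOn T U) (hT' : IsSmoothOn T' U) (a : Fin n)
    (I : Fin r → Fin n) :
    covDeriv g (fun v I => T v I + T' v I) u a I = covDeriv g T u a I + covDeriv g T' u a I := by
  simp only [covDeriv_eq, derAct, pderiv_add a (hT u hu I) (hT' u hu I), mul_add,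
    Finset.sum_add_distrib]
  ring

theorem covDeriv_const_mul (hu : u ∈ U) (hT : IsSmoothOn T U) (c : ℝ) (a : Fin n)
    (I : Fin r → Fin n) :
    covDeriv g (fun v I => c * T v I) u a I = c * covDeriv g T u a I := by
  simp only [covDeriv_eq, derAct, pderiv_const_mul a c (hT u hu I), mul_sub, Finset.mul_sum]
  congr 1
  exact Finset.sum_congr rfl fun _ _ => Finset.sum_congr rfl fun _ _ => by ring

theorem covDeriv_sum (hu : u ∈ U) {ι : Type*} (s : Finset ι)
    {F : ι → EuclideanSpace ℝ (Fin n) → (Fin r → Fin n) → ℝ} (hF : ∀ i ∈ s, IsSmoothOn (F i) U)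
    (a : Fin n) (I : Fin r → Fin n) :
    covDeriv g (fun v I => ∑ i ∈ s, F i v I) u a I = ∑ i ∈ s, covDeriv g (F i) u a I := by
  simp only [covDeriv_eq, derAct, pderiv_sum a s fun i hi => hF i hi u hu I,
    Finset.sum_sub_distrib, Finset.mul_sum]
  congr 1
  exact (Finset.sum_congr rfl fun _ _ => Finset.sum_comm).trans Finset.sum_comm

/-- ∇ commutes with permutations of the slots. Symmetries and equations that involve reordered
indices thereby pass to derivatives. -/
theorem covDeriv_reindex (σ : Equiv.Perm (Fin r)) (a : Fin n) (I : Fin r → Fin n) :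
    covDeriv g (fun v I => T v (I ∘ σ)) u a I = covDeriv g T u a (I ∘ σ) := by
  simp only [covDeriv_eq, derAct, update_comp_perm]
  congr 1
  exact (Equiv.sum_comp σ (fun i => ∑ f, christoffel g u f a (I i) *
    T u (Function.update I i f ∘ σ))).symm

theorem IsSmoothOn.reindex (hT : IsSmoothOn T U) (σ : Equiv.Perm (Fin r)) :
    IsSmoothOn (fun v I => T v (I ∘ σ)) U := fun u hu I => hT u hu (I ∘ σ)

theorem IsSmoothOn.const_mul (hT : IsSmoothOn T U) (c : ℝ) :
    IsSmoothOn (fun v I => c * T v I) U := fun u hu I => contDiffAt_const.mul (hT u hu I)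

theorem IsSmoothOn.sum {ι : Type*} (s : Finset ι)
    {F : ι → EuclideanSpace ℝ (Fin n) → (Fin r → Fin n) → ℝ} (hF : ∀ i ∈ s, IsSmoothOn (F i) U) :
    IsSmoothOn (fun v I => ∑ i ∈ s, F i v I) U :=
  fun u hu I => ContDiffAt.sum fun i hi => hF i hi u hu I

theorem IsMetricOn.isSmoothOn_covDeriv (hg : IsMetricOn g U) (hT : IsSmoothOn T U) (a : Fin n) :
    IsSmoothOn (fun v => covDeriv g T v a) U := by
  intro u hu I
  exact (contDiffAt_pderiv a (hT u hu I)).sub (ContDiffAt.sum fun i _ => ContDiffAt.sum fun f _ =>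
    (hg.contDiffAt_christoffel hu f a (I i)).mul (hT u hu _))

theorem IsMetricOn.isSmoothOn_nabla (hg : IsMetricOn g U) (hT : IsSmoothOn T U) :
    IsSmoothOn (nabla g T) U :=
  fun u hu J => hg.isSmoothOn_covDeriv hT (J 0) u hu _

theorem covDeriv_isAlt (hU : IsOpen U) (hu : u ∈ U) (hT : IsSmoothOn T U)
    (hA : ∀ v ∈ U, IsAlt (T v)) (a : Fin n) : IsAlt (covDeriv g T u a) := by
  intro σ I
  rw [← covDeriv_reindex, ← covDeriv_const_mul hu hT]
  exact covDeriv_congr hU hu (fun v hv => funext fun I => hA v hv σ I) a I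

theorem nabla_vecCons (b : Fin n) (I : Fin r → Fin n) :
    nabla g T u (Matrix.vecCons b I) = covDeriv g T u b I := rfl

theorem covDeriv_nabla (a b : Fin n) (I : Fin r → Fin n) :
    covDeriv g (nabla g T) u a (Matrix.vecCons b I)
      = pderiv a (fun v => covDeriv g T v b I) u
        - ∑ f, christoffel g u f a b * covDeriv g T u f I
        - derAct (fun f c => christoffel g u f a c) (covDeriv g T u b) I := by
  rw [covDeriv_eq, derAct, Fin.sum_univ_succ]
  simp only [update_vecCons_zero, update_vecCons_succ, nabla_vecCons, Matrix.cons_val_zero,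
    Matrix.cons_val_succ]
  rw [derAct]
  ring

theorem IsMetricOn.pderiv_covDeriv (hg : IsMetricOn g U) (hu : u ∈ U) (hT : IsSmoothOn T U)
    (a b : Fin n) (I : Fin r → Fin n) :
    pderiv a (fun v => covDeriv g T v b I) u
      = pderiv a (fun v => pderiv b (fun v => T v I) v) u
        - derAct (fun f c => pderiv a (fun v => christoffel g v f b c) u) (T u) I
        - derAct (fun f c => christoffel g u f b c) (fun I => pderiv a (fun v => T v I) u) I := by
  have s := hg.contDiffAt_christoffel hu
  simp only [covDeriv]
  rw [pderiv_sub a (contDiffAt_pderiv b (hT u hu I)) (ContDiffAt.sum fun i _ =>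
    ContDiffAt.sum fun f _ => (s f b (I i)).mul (hT u hu _)),
    pderiv_sum a _ fun i _ => ContDiffAt.sum fun f _ => (s f b (I i)).mul (hT u hu _)]
  simp only [fun i => pderiv_sum a Finset.univ fun f _ => (s f b (I i)).mul
    (hT u hu (Function.update I i f)), pderiv_mul a (s _ b _) (hT u hu _),
    Finset.sum_add_distrib, derAct]
  ring

/-- The Ricci identity. -/
theorem IsMetricOn.ricci_identity (hg : IsMetricOn g U) (hu : u ∈ U) (hT : IsSmoothOn T U)
    (a b : Fin n) (I : Fin r → Fin n) :
    covDeriv g (nabla g T) u a (Matrix.vecCons b I)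
        - covDeriv g (nabla g T) u b (Matrix.vecCons a I)
      = derAct (fun f c => riemannMixed g u a b c f) (T u) I := by
  have h1 : ∀ a b, derAct (fun f c => christoffel g u f a c) (covDeriv g T u b) I
      = derAct (fun f c => christoffel g u f a c) (fun I => pderiv b (fun v => T v I) u) I
        - derAct (fun f c => christoffel g u f a c)
          (derAct (fun f c => christoffel g u f b c) (T u)) I := by
    intro a b
    simp only [derAct, covDeriv, mul_sub, Finset.sum_sub_distrib]
  have h2 := derAct_derAct (fun f c => christoffel g u f a c) (fun f c => christoffel g u f b c)
    (T u) I
  have h3 : derAct (fun f c => riemannMixed g u a b c f) (T u) I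
      = derAct (fun f c => pderiv b (fun v => christoffel g v f a c) u) (T u) I
        - derAct (fun f c => pderiv a (fun v => christoffel g v f b c) u) (T u) I
        + derAct (fun h c => ∑ f, (christoffel g u f a c * christoffel g u h b f
          - christoffel g u f b c * christoffel g u h a f)) (T u) I := by
    simp only [derAct, riemannMixed, add_mul, sub_mul, Finset.sum_add_distrib,
      Finset.sum_sub_distrib]
  -- Second partials cancel by Schwarz, the term of the derivative slot by the symmetry of Γ, and
  -- the Γ·∂T terms crosswise. The ΓΓ terms form the commutator in `h2`.
  rw [covDeriv_nabla, covDeriv_nabla, hg.pderiv_covDeriv hu hT, hg.pderiv_covDeriv hu hT, h1, h1,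
    h3, pderiv_comm a b (hT u hu I)]
  simp only [hg.christoffel_symm hu _ a b]
  linear_combination h2

theorem IsMetricOn.riemannMixed_eq (hg : IsMetricOn g U) (hu : u ∈ U) (a b c f : Fin n) :
    riemannMixed g u a b c f = - raise₁ (g u) (riemann g u) f c a b := by
  have hK := hg.isCurvature hu
  have h1 : ∀ d, (g u)⁻¹ f d * riemann g u d c a b
      = - ∑ e, riemannMixed g u a b c e * ((g u)⁻¹ f d * g u d e) := by
    intro d
    rw [hK.pair, hK.anti_right, riemann, mul_neg, Finset.mul_sum]
    congr 1
    exact Finset.sum_congr rfl fun e _ => by rw [hg.symm u hu d e]; ring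
  simp only [raise₁, h1, Finset.sum_neg_distrib, neg_neg]
  rw [Finset.sum_comm]
  simp only [← Finset.mul_sum, sum_inv_mul (hg.isUnit_det u hu)]
  simp

theorem IsMetricOn.derAct_riemannMixed (hg : IsMetricOn g U) (hu : u ∈ U) {k : ℕ}
    {Y : (Fin (k + 2) → Fin n) → ℝ} (hY : IsAlt Y) (a b c d : Fin n) (E : Fin k → Fin n) :
    derAct (fun f c => riemannMixed g u a b c f) Y (Matrix.vecCons c (Matrix.vecCons d E))
      = curvAct (g u) (riemann g u) Y a b c d E := by
  simp only [hg.riemannMixed_eq hu, derAct, Fin.sum_univ_succ, update_vecCons_zero,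
    update_vecCons_succ, Matrix.cons_val_zero, Matrix.cons_val_succ, curvAct, curvForm, curvFormHat]
  have h : ∀ f, Y (Matrix.vecCons f (Matrix.vecCons d E))
    = - Y (Matrix.vecCons d (Matrix.vecCons f E)) := fun f => hY.swap_two _ _ _
  simp only [h, neg_mul, mul_neg, neg_neg, Finset.sum_neg_distrib]
  ring

end CovariantDerivative

/-! ### Differentiating g ∧ h and the conformal Killing–Yano equation in coordinates. -/

/-- The tensor product of the metric with `h`. -/
def metricTensor {n m : ℕ} (g : EuclideanSpace ℝ (Fin n) → Matrix (Fin n) (Fin n) ℝ)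
    (h : EuclideanSpace ℝ (Fin n) → (Fin m → Fin n) → ℝ) (v : EuclideanSpace ℝ (Fin n))
    (J : Fin (m + 2) → Fin n) : ℝ :=
  g v (J 0) (J 1) * h v (fun j => J j.succ.succ)

/-- `g_{x[y} h_{b₂ ⋯ b_p]}` as a tensor field with indices `x y b₂ ⋯ b_p`. -/
def wedgeTensor {n m : ℕ} (g : EuclideanSpace ℝ (Fin n) → Matrix (Fin n) (Fin n) ℝ)
    (h : EuclideanSpace ℝ (Fin n) → (Fin m → Fin n) → ℝ) (v : EuclideanSpace ℝ (Fin n))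
    (J : Fin (m + 2) → Fin n) : ℝ :=
  ((m + 1).factorial : ℝ)⁻¹ * ∑ σ : Equiv.Perm (Fin (m + 1)),
    ((Equiv.Perm.sign σ : ℤ) : ℝ) * metricTensor g h v (J ∘ Equiv.Perm.decomposeFin.symm (0, σ))

/-- The conformal Killing–Yano equation on an open subset of coordinate space. -/
structure IsCKYOn {n m : ℕ} (g : EuclideanSpace ℝ (Fin n) → Matrix (Fin n) (Fin n) ℝ)
    (Y : EuclideanSpace ℝ (Fin n) → (Fin (m + 1) → Fin n) → ℝ)
    (h : EuclideanSpace ℝ (Fin n) → (Fin m → Fin n) → ℝ) (U : Set (EuclideanSpace ℝ (Fin n))) :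
    Prop where
  smooth : IsSmoothOn Y U
  isAlt : ∀ u ∈ U, IsAlt (Y u)
  isAlt' : ∀ u ∈ U, IsAlt (h u)
  eqn : ∀ u ∈ U, ∀ (a b : Fin n) (B : Fin m → Fin n),
    covDeriv g Y u a (Matrix.vecCons b B) + covDeriv g Y u b (Matrix.vecCons a B)
      = 2 * metricWedge (g u) (h u) a b B + 2 * metricWedge (g u) (h u) b a B

section Wedge

variable {n m : ℕ} {g : EuclideanSpace ℝ (Fin n) → Matrix (Fin n) (Fin n) ℝ}
  {U : Set (EuclideanSpace ℝ (Fin n))} {u : EuclideanSpace ℝ (Fin n)}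
  {h : EuclideanSpace ℝ (Fin n) → (Fin m → Fin n) → ℝ}

theorem wedgeTensor_vecCons (x y : Fin n) (B : Fin m → Fin n) :
    wedgeTensor g h u (Matrix.vecCons x (Matrix.vecCons y B))
      = metricWedge (g u) (h u) x y B := by
  simp only [wedgeTensor, vecCons_comp_decompose]
  rfl

theorem IsMetricOn.isSmoothOn_metricTensor (hg : IsMetricOn g U) (hh : IsSmoothOn h U) :
    IsSmoothOn (metricTensor g h) U :=
  fun u hu _ => (hg.smooth u hu _ _).mul (hh u hu _)

theorem IsMetricOn.isSmoothOn_wedgeTensor (hg : IsMetricOn g U) (hh : IsSmoothOn h U) :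
    IsSmoothOn (wedgeTensor g h) U :=
  (IsSmoothOn.sum _ fun _ _ =>
    ((hg.isSmoothOn_metricTensor hh).reindex _).const_mul _).const_mul _

/-- Metric compatibility: the Christoffel terms of the two metric slots cancel ∂g. -/
theorem IsMetricOn.covDeriv_metricTensor (hg : IsMetricOn g U) (hu : u ∈ U)
    (hh : IsSmoothOn h U) (c x y : Fin n) (B : Fin m → Fin n) :
    covDeriv g (metricTensor g h) u c (Matrix.vecCons x (Matrix.vecCons y B))
      = g u x y * covDeriv g h u c B := by
  have e : ∀ v x y (B : Fin m → Fin n),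
      metricTensor g h v (Matrix.vecCons x (Matrix.vecCons y B)) = g v x y * h v B :=
    fun _ _ _ _ => rfl
  simp only [covDeriv, Fin.sum_univ_succ, update_vecCons_zero, update_vecCons_succ,
    Matrix.cons_val_zero, Matrix.cons_val_succ, e, pderiv_mul c (hg.smooth u hu x y) (hh u hu B),
    hg.pderiv_metric hu]
  have s1 : ∑ f, christoffel g u f c x * (g u f y * h u B) = christoffelLow g u y c x * h u B := by
    simp only [← mul_assoc, ← Finset.sum_mul, hg.sum_christoffel_mul hu]
  have s2 : ∑ f, christoffel g u f c y * (g u x f * h u B) = christoffelLow g u x c y * h u B := by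
    simp only [hg.symm u hu x, ← mul_assoc, ← Finset.sum_mul, hg.sum_christoffel_mul hu]
  have s3 : ∑ i, ∑ f, christoffel g u f c (B i) * (g u x y * h u (Function.update B i f))
      = g u x y * ∑ i, ∑ f, christoffel g u f c (B i) * h u (Function.update B i f) := by
    simp only [Finset.mul_sum]
    exact Finset.sum_congr rfl fun _ _ => Finset.sum_congr rfl fun _ _ => by ring
  rw [s1, s2, s3]
  ring

/-- `wedgeTensor` is a linear combination of slot permutations of g ⊗ h, each of which commutes with
∇, so only `h` is differentiated. -/
theorem IsMetricOn.covDeriv_wedgeTensor (hg : IsMetricOn g U) (hu : u ∈ U)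
    (hh : IsSmoothOn h U) (c x y : Fin n) (B : Fin m → Fin n) :
    covDeriv g (wedgeTensor g h) u c (Matrix.vecCons x (Matrix.vecCons y B))
      = metricWedge (g u) (covDeriv g h u c) x y B := by
  have s := hg.isSmoothOn_metricTensor hh
  unfold wedgeTensor
  rw [covDeriv_const_mul hu (IsSmoothOn.sum _ fun _ _ => (s.reindex _).const_mul _),
    covDeriv_sum hu _ fun _ _ => (s.reindex _).const_mul _]
  simp only [fun σ c => covDeriv_const_mul (g := g) hu (s.reindex σ) c, covDeriv_reindex,
    vecCons_comp_decompose]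
  unfold metricWedge antisym
  congr 1
  refine Finset.sum_congr rfl fun σ _ => ?_
  congr 1
  have : (Matrix.vecCons y B) ∘ σ = Matrix.vecCons (Matrix.vecCons y B (σ 0))
      (fun j => Matrix.vecCons y B (σ j.succ)) := by
    funext j
    refine Fin.cases ?_ (fun j => ?_) j <;> simp
  rw [this, hg.covDeriv_metricTensor hu hh]

end Wedge

/-! ### Integrability of the conformal Killing–Yano equation. -/

section ConformalKillingYano

variable {n m k : ℕ} {g : EuclideanSpace ℝ (Fin n) → Matrix (Fin n) (Fin n) ℝ}
  {U : Set (EuclideanSpace ℝ (Fin n))} {u : EuclideanSpace ℝ (Fin n)}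

/-- Trace of the defining equation: the left side is twice the divergence, and each of the two wedge
terms on the right contributes 2(n - m)/(m + 1) h. -/
theorem IsCKYOn.eq_divergence {Y : EuclideanSpace ℝ (Fin n) → (Fin (m + 1) → Fin n) → ℝ}
    {h : EuclideanSpace ℝ (Fin n) → (Fin m → Fin n) → ℝ} (hg : IsMetricOn g U)
    (hY : IsCKYOn g Y h U) (hmn : m < n) (hu : u ∈ U) (B : Fin m → Fin n) :
    h u B = divergence g Y u B := by
  have hsym := hg.symm u hu
  have hdet := hg.isUnit_det u hu
  have hmn' : (m : ℝ) < n := by exact_mod_cast hmn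
  have hm : (m : ℝ) + 1 ≠ 0 := by positivity
  have h1 : contract (g u) (fun a b => covDeriv g Y u a (Matrix.vecCons b B)
      + covDeriv g Y u b (Matrix.vecCons a B))
      = contract (g u) (fun a b => 2 * metricWedge (g u) (h u) a b B
        + 2 * metricWedge (g u) (h u) b a B) := by
    congr 1; funext a b; exact hY.eqn u hu a b B
  have h2 : contract (g u) (fun a b => metricWedge (g u) (h u) a b B)
      = ((m : ℝ) + 1)⁻¹ * ((n : ℝ) - m) * h u B := by
    have e : ∀ a b, metricWedge (g u) (h u) a b B = ((m : ℝ) + 1)⁻¹ * (h u B * g u a b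
        - ∑ i, g u a (B i) * h u (Function.update B i b)) := by
      intro a b
      rw [metricWedge_eq _ (hY.isAlt' u hu)]
      ring
    have e2 : ∀ i, contract (g u) (fun a b => g u a (B i) * h u (Function.update B i b))
        = h u B := by
      intro i
      rw [contract_metric_left hsym hdet (fun b => h u (Function.update B i b))]
      simp
    simp only [e]
    rw [contract_mul (fun a b => h u B * g u a b
      - ∑ i, g u a (B i) * h u (Function.update B i b)), contract_sub,
      contract_mul (fun a b => g u a b), contract_metric hsym hdet, contract_sum]
    simp only [e2]
    simp
    ring
  simp only [contract_add] at h1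
  rw [contract_swap hsym (fun a b => covDeriv g Y u a (Matrix.vecCons b B)), contract_mul,
    contract_mul, contract_swap hsym (fun a b => metricWedge (g u) (h u) a b B), h2] at h1
  rw [divergence]
  change _ = _ * contract (g u) (fun a b => covDeriv g Y u a (Matrix.vecCons b B))
  have hn : (n : ℝ) + 1 - (m + 1) ≠ 0 := by linarith
  field_simp at h1 ⊢
  linarith

/-- No regularity of `h` is assumed; on the open set it coincides with the divergence, which is
smooth. -/
theorem IsCKYOn.smooth' {Y : EuclideanSpace ℝ (Fin n) → (Fin (m + 1) → Fin n) → ℝ}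
    {h : EuclideanSpace ℝ (Fin n) → (Fin m → Fin n) → ℝ} (hg : IsMetricOn g U)
    (hY : IsCKYOn g Y h U) (hmn : m < n) : IsSmoothOn h U := by
  intro u hu B
  have h1 : ContDiffAt ℝ ∞ (fun v => divergence g Y v B) u :=
    contDiffAt_const.mul (ContDiffAt.sum fun a _ => ContDiffAt.sum fun b _ =>
      (hg.contDiffAt_inv hu a b).mul (hg.isSmoothOn_covDeriv hY.smooth a u hu _))
  exact h1.congr_of_eventuallyEq (Filter.eventuallyEq_of_mem (hg.isOpen.mem_nhds hu)
    fun v hv => hY.eq_divergence hg hmn hv B)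

theorem IsCKYOn.covDeriv_eqn {Y : EuclideanSpace ℝ (Fin n) → (Fin (m + 1) → Fin n) → ℝ}
    {h : EuclideanSpace ℝ (Fin n) → (Fin m → Fin n) → ℝ} (hg : IsMetricOn g U)
    (hY : IsCKYOn g Y h U) (hmn : m < n) (hu : u ∈ U) (c a b : Fin n) (B : Fin m → Fin n) :
    covDeriv g (nabla g Y) u c (Matrix.vecCons a (Matrix.vecCons b B))
        + covDeriv g (nabla g Y) u c (Matrix.vecCons b (Matrix.vecCons a B))
      = 2 * metricWedge (g u) (covDeriv g h u c) a b B
        + 2 * metricWedge (g u) (covDeriv g h u c) b a B := by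
  have hh := hY.smooth' hg hmn
  have sN := hg.isSmoothOn_nabla hY.smooth
  have sW := hg.isSmoothOn_wedgeTensor hh
  have hsw : ∀ (x y : Fin n) (B : Fin m → Fin n),
      Matrix.vecCons x (Matrix.vecCons y B) ∘ Equiv.swap 0 1
        = Matrix.vecCons y (Matrix.vecCons x B) := by
    intro x y B
    have := vecCons_comp_swap x (Matrix.vecCons y B) 0
    rwa [update_vecCons_zero] at this
  -- The equation holds throughout the open set as an equality of tensor fields, with the exchange
  -- of a and b written as a slot permutation, so it may be differentiated.
  have key : covDeriv g (fun v J => nabla g Y v J + nabla g Y v (J ∘ Equiv.swap 0 1)) u c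
        (Matrix.vecCons a (Matrix.vecCons b B))
      = covDeriv g (fun v J => 2 * wedgeTensor g h v J
          + 2 * wedgeTensor g h v (J ∘ Equiv.swap 0 1)) u c
        (Matrix.vecCons a (Matrix.vecCons b B)) := by
    refine covDeriv_congr hg.isOpen hu (fun v hv => funext fun J => ?_) c _
    obtain ⟨x, y, B, rfl⟩ : ∃ (x y : Fin n) (B : Fin m → Fin n),
        J = Matrix.vecCons x (Matrix.vecCons y B) :=
      ⟨J 0, J 1, fun j => J j.succ.succ, by
        funext j
        refine Fin.cases rfl (fun j => ?_) j
        refine Fin.cases rfl (fun j => ?_) j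
        rfl⟩
    simp only [hsw, wedgeTensor_vecCons, nabla_vecCons]
    exact hY.eqn v hv x y B
  rw [covDeriv_add hu sN (sN.reindex _), covDeriv_add hu (sW.const_mul 2)
    ((sW.reindex _).const_mul 2), covDeriv_const_mul hu sW, covDeriv_const_mul hu (sW.reindex _),
    covDeriv_reindex, covDeriv_reindex, hsw, hg.covDeriv_wedgeTensor hu hh,
    hg.covDeriv_wedgeTensor hu hh] at key
  exact key

theorem covDeriv_nabla_anti {Y : EuclideanSpace ℝ (Fin n) → (Fin (k + 2) → Fin n) → ℝ}
    (hg : IsMetricOn g U) (hY : IsSmoothOn Y U) (hA : ∀ v ∈ U, IsAlt (Y v)) (hu : u ∈ U)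
    (c a b d : Fin n) (E : Fin k → Fin n) :
    covDeriv g (nabla g Y) u c (Matrix.vecCons a (Matrix.vecCons b (Matrix.vecCons d E)))
      = - covDeriv g (nabla g Y) u c
        (Matrix.vecCons a (Matrix.vecCons d (Matrix.vecCons b E))) := by
  set σ : Equiv.Perm (Fin (k + 3)) := Equiv.Perm.decomposeFin.symm (0, Equiv.swap 0 1) with hσ
  have h1 : Matrix.vecCons a (Matrix.vecCons b (Matrix.vecCons d E)) ∘ σ
      = Matrix.vecCons a (Matrix.vecCons d (Matrix.vecCons b E)) := by
    rw [hσ, vecCons_comp_decompose]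
    have := vecCons_comp_swap b (Matrix.vecCons d E) 0
    rw [update_vecCons_zero] at this
    exact congrArg _ this
  have h2 : covDeriv g (fun v J => nabla g Y v (J ∘ σ)) u c
      (Matrix.vecCons a (Matrix.vecCons b (Matrix.vecCons d E)))
      = covDeriv g (fun v J => (-1) * nabla g Y v J) u c
      (Matrix.vecCons a (Matrix.vecCons b (Matrix.vecCons d E))) := by
    refine covDeriv_congr hg.isOpen hu (fun v hv => funext fun J => ?_) c _
    have hJ : J = Matrix.vecCons (J 0) (fun j => J j.succ) := by
      funext j
      refine Fin.cases rfl (fun j => ?_) j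
      rfl
    rw [hJ, hσ, vecCons_comp_decompose, nabla_vecCons, nabla_vecCons,
      (covDeriv_isAlt hg.isOpen hv hY hA (J 0)).swap (by simp)]
    ring
  rw [covDeriv_reindex, h1, covDeriv_const_mul hu (hg.isSmoothOn_nabla hY)] at h2
  linarith

/-- `A` plays the role of ∇∇Y and `N` that of ∇h. The antisymmetry of `A` in its last two displayed
indices is the obstruction that yields the condition. -/
theorem symCond_of_secondDeriv {G : Matrix (Fin n) (Fin n) ℝ} (hG : ∀ i j, G i j = G j i)
    {K : Fin n → Fin n → Fin n → Fin n → ℝ} {Y : (Fin (k + 2) → Fin n) → ℝ} (hY : IsAlt Y)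
    {N : Fin n → (Fin (k + 1) → Fin n) → ℝ} (hN : ∀ c, IsAlt (N c))
    {A : Fin n → Fin n → (Fin (k + 2) → Fin n) → ℝ}
    (hA : ∀ c a b d E, A c a (Matrix.vecCons b (Matrix.vecCons d E))
      = - A c a (Matrix.vecCons d (Matrix.vecCons b E)))
    (hR : ∀ a b c d E, A a b (Matrix.vecCons c (Matrix.vecCons d E))
      - A b a (Matrix.vecCons c (Matrix.vecCons d E)) = curvAct G K Y a b c d E)
    (hQ : ∀ c a b B, A c a (Matrix.vecCons b B) + A c b (Matrix.vecCons a B)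
      = 2 * metricWedge G (N c) a b B + 2 * metricWedge G (N c) b a B)
    (a b c d : Fin n) (E : Fin k → Fin n) :
    symCond G K Y (fun c d E => N c (Matrix.vecCons d E) + N d (Matrix.vecCons c E)) a b c d E
      = 0 := by
  have hW : ∀ c a b d, metricWedge G (N c) a b (Matrix.vecCons d E)
      = ((k : ℝ) + 2)⁻¹ * (G a b * N c (Matrix.vecCons d E) - G a d * N c (Matrix.vecCons b E)
        - metricHat G (fun c d E => N c (Matrix.vecCons d E)) E c d b a) := by
    intro c a b d
    rw [metricWedge_eq G (hN c), Fin.sum_univ_succ]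
    simp only [update_vecCons_zero, update_vecCons_succ, Matrix.cons_val_zero,
      Matrix.cons_val_succ, metricHat, hG a]
    push_cast
    rw [show (k : ℝ) + 1 + 1 = k + 2 by ring]
    ring
  have hM : ∀ x y z w, metricHat G (fun c d E => N c (Matrix.vecCons d E)) E x y z w
      = - metricHat G (fun c d E => N c (Matrix.vecCons d E)) E x z y w := by
    intro x y z w
    simp only [metricHat, ← Finset.sum_neg_distrib]
    exact Finset.sum_congr rfl fun i _ => by rw [(hN x).vecCons_update y z]; ring
  have hS : ∀ x y z w, metricHat G (fun c d E => N c (Matrix.vecCons d E)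
      + N d (Matrix.vecCons c E)) E x y z w
      = metricHat G (fun c d E => N c (Matrix.vecCons d E)) E x y z w
        + metricHat G (fun c d E => N c (Matrix.vecCons d E)) E y x z w := by
    intro x y z w
    simp only [metricHat, mul_add, Finset.sum_add_distrib]
  have hc : ∀ a b c d, curvAct G K Y a b c d E = - curvAct G K Y a b d c E := by
    intro a b c d
    simp only [curvAct]
    rw [curvFormHat_anti_right hY]
    ring
  -- Koszul's trick: three copies of `hQ` with signs +, -, + reduce to twice one second derivative,
  -- after the order of differentiation is restored by `hR`.
  have X : ∀ b d, 2 * A c a (Matrix.vecCons b (Matrix.vecCons d E))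
      = (2 * metricWedge G (N c) a b (Matrix.vecCons d E)
          + 2 * metricWedge G (N c) b a (Matrix.vecCons d E))
        - (2 * metricWedge G (N b) c a (Matrix.vecCons d E)
          + 2 * metricWedge G (N b) a c (Matrix.vecCons d E))
        + (2 * metricWedge G (N a) b c (Matrix.vecCons d E)
          + 2 * metricWedge G (N a) c b (Matrix.vecCons d E))
        - curvAct G K Y c b a d E + curvAct G K Y b a c d E - curvAct G K Y a c b d E := by
    intro b d
    linarith [hQ c a b (Matrix.vecCons d E), hQ b c a (Matrix.vecCons d E),
      hQ a b c (Matrix.vecCons d E), hR c b a d E, hR b a c d E, hR a c b d E]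
  -- Adding the formula to its copy with b and d exchanged eliminates `A`.
  have X1 := X b d
  have X2 := X d b
  have X3 := hA c a b d E
  have X4 := hc a c b d
  unfold symCond
  simp only [hS, div_eq_mul_inv]
  simp only [hW] at X1 X2
  generalize ((k : ℝ) + 2)⁻¹ = q at *
  simp only [hG b a, hG c a, hG d a, hG c b, hG d b, hG d c, hM _ b a, hM _ d a,
    hM _ c b, hM _ d b, hM _ d c] at X1 X2 ⊢
  linarith

/-- The integrability condition of the conformal Killing–Yano equation. -/
theorem IsCKYOn.symCond {Y : EuclideanSpace ℝ (Fin n) → (Fin (k + 2) → Fin n) → ℝ}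
    {h : EuclideanSpace ℝ (Fin n) → (Fin (k + 1) → Fin n) → ℝ} (hg : IsMetricOn g U)
    (hY : IsCKYOn g Y h U) (hkn : k + 1 < n) (hu : u ∈ U) (a b c d : Fin n) (E : Fin k → Fin n) :
    symCond (g u) (riemann g u) (Y u) (symDeriv g h u) a b c d E = 0 :=
  symCond_of_secondDeriv (hg.symm u hu) (hY.isAlt u hu)
    (covDeriv_isAlt hg.isOpen hu (hY.smooth' hg hkn) hY.isAlt')
    (A := fun c a I => covDeriv g (nabla g Y) u c (Matrix.vecCons a I))
    (covDeriv_nabla_anti hg hY.smooth hY.isAlt hu)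
    (fun a b c d E => by
      rw [hg.ricci_identity hu hY.smooth, hg.derAct_riemannMixed hu (hY.isAlt u hu)])
    (hY.covDeriv_eqn hg hkn hu) a b c d E

end ConformalKillingYano

/-! ### From fields on the manifold to components in a chart. -/

section Components

variable {n : ℕ} {M : Type*} [TopologicalSpace M] [ChartedSpace (EuclideanSpace ℝ (Fin n)) M]
  {e : OpenPartialHomeomorph M (EuclideanSpace ℝ (Fin n))}

theorem mdifferentiable_of_mem_maximalAtlas (he : e ∈ IsManifold.maximalAtlas (𝓡 n) ∞ M) :
    e.MDifferentiable (𝓡 n) (𝓡 n) :=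
  ⟨(contMDiffOn_of_mem_maximalAtlas he).mdifferentiableOn (by simp),
    (contMDiffOn_symm_of_mem_maximalAtlas he).mdifferentiableOn (by simp)⟩

theorem mfderiv_symm_eq_sum (u v : EuclideanSpace ℝ (Fin n)) :
    mfderiv (𝓡 n) (𝓡 n) e.symm u v = ∑ i, v i • coordFrame e u i := by
  have h : v = ∑ i, v i • EuclideanSpace.single i (1 : ℝ) := by
    simpa using ((EuclideanSpace.basisFun (Fin n) ℝ).sum_repr v).symm
  conv_lhs => rw [h]
  refine (map_sum (mfderiv (𝓡 n) (𝓡 n) e.symm u) _ _).trans ?_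
  exact Finset.sum_congr rfl fun i _ => map_smul (mfderiv (𝓡 n) (𝓡 n) e.symm u) _ _

theorem isAlt_formComp {r : ℕ} (α : ∀ x : M, TangentSpace (𝓡 n) x [⋀^Fin r]→ₗ[ℝ] ℝ)
    (u : EuclideanSpace ℝ (Fin n)) : IsAlt (formComp α e u) := by
  intro σ I
  have := (α (e.symm u)).map_perm (fun j => coordFrame e u (I j)) σ
  simp only [formComp]
  refine this.trans ?_
  simp [Units.smul_def]

theorem contDiffAt_comp_symm (he : e ∈ IsManifold.maximalAtlas (𝓡 n) ∞ M) {Ω : M → ℝ}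
    (hΩ : ContMDiff (𝓡 n) 𝓘(ℝ, ℝ) ∞ Ω) {u : EuclideanSpace ℝ (Fin n)} (hu : u ∈ e.target) :
    ContDiffAt ℝ ∞ (fun v => Ω (e.symm v)) u := by
  have h1 : ContMDiffOn (𝓡 n) 𝓘(ℝ, ℝ) ∞ (Ω ∘ e.symm) e.target :=
    hΩ.comp_contMDiffOn (contMDiffOn_symm_of_mem_maximalAtlas he)
  exact (contMDiffOn_iff_contDiffOn.mp h1).contDiffAt (e.open_target.mem_nhds hu)

end Components

section Charts

variable {n : ℕ} {M : Type*} [TopologicalSpace M] [ChartedSpace (EuclideanSpace ℝ (Fin n)) M]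
  [IsManifold (𝓡 n) ∞ M] {e : OpenPartialHomeomorph M (EuclideanSpace ℝ (Fin n))}

theorem Metric.isMetricOn (g : Metric n M) (he : e ∈ IsManifold.maximalAtlas (𝓡 n) ∞ M) :
    IsMetricOn (g.comp e) e.target where
  isOpen := e.open_target
  symm u _ i j := g.symm _ _ _
  smooth u hu i j := (g.smooth e he i j).contDiffAt (e.open_target.mem_nhds hu)
  isUnit_det u hu := by
    rw [← Matrix.isUnit_iff_isUnit_det, ← Matrix.mulVec_injective_iff_isUnit]
    refine (injective_iff_map_eq_zero (g.comp e u).mulVecLin).mpr fun v hv => ?_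
    have hD := mdifferentiable_of_mem_maximalAtlas he
    have h0 : ∀ i, ∑ j, v j * g.form (e.symm u) (coordFrame e u i) (coordFrame e u j) = 0 := by
      intro i
      refine Eq.trans ?_ (congrFun hv i)
      exact Finset.sum_congr rfl fun j _ => mul_comm _ _
    -- A null vector of the Gram matrix is orthogonal to the coordinate frame, which spans the
    -- tangent space; nondegeneracy of the form makes it vanish.
    have h1 : mfderiv (𝓡 n) (𝓡 n) e.symm u (WithLp.toLp 2 v) = 0 := by
      refine g.nondegenerate _ _ fun w => ?_
      obtain ⟨(w : EuclideanSpace ℝ (Fin n)), rfl⟩ := hD.symm.mfderiv_surjective hu w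
      rw [g.symm]
      refine (congrArg₂ (fun X Z => g.form (e.symm u) X Z) (mfderiv_symm_eq_sum u w)
        (mfderiv_symm_eq_sum u (WithLp.toLp 2 v))).trans ?_
      simp only [map_sum, map_smul, LinearMap.sum_apply, LinearMap.smul_apply, smul_eq_mul]
      simp only [Finset.mul_sum]
      rw [Finset.sum_comm]
      refine Finset.sum_eq_zero fun i _ => ?_
      refine Eq.trans ?_ (mul_eq_zero_of_right (w.ofLp i) (h0 i))
      rw [Finset.mul_sum]
      exact Finset.sum_congr rfl fun j _ => mul_left_comm _ _ _
    have h2 := hD.symm.mfderiv_injective hu (h1.trans (map_zero _).symm)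
    funext i
    exact congrArg (fun z : EuclideanSpace ℝ (Fin n) => z i) h2

theorem IsConformalKillingYano.isCKYOn {m : ℕ} {g : Metric n M}
    {Y : ∀ x : M, TangentSpace (𝓡 n) x [⋀^Fin (m + 1)]→ₗ[ℝ] ℝ}
    {h : ∀ x : M, TangentSpace (𝓡 n) x [⋀^Fin m]→ₗ[ℝ] ℝ} (hY : IsSmoothForm Y)
    (hh : IsConformalKillingYano g Y h) (he : e ∈ IsManifold.maximalAtlas (𝓡 n) ∞ M) :
    IsCKYOn (g.comp e) (formComp Y e) (formComp h e) e.target where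
  smooth _ hu I := (hY e he I).contDiffAt (e.open_target.mem_nhds hu)
  isAlt _ _ := isAlt_formComp Y _
  isAlt' _ _ := isAlt_formComp h _
  eqn := hh e he

end Charts

end CKY

end

/-! ### Assembly in an arbitrary chart. -/

theorem mainTheorem1 {n k : ℕ} (hkn : k + 2 < n) {M : Type*} [TopologicalSpace M]
    [ChartedSpace (EuclideanSpace ℝ (Fin n)) M] [IsManifold (𝓡 n) ∞ M] (g : CKY.Metric n M)
    (Y : ∀ x : M, TangentSpace (𝓡 n) x [⋀^Fin (k + 2)]→ₗ[ℝ] ℝ) (hY : CKY.IsSmoothForm Y) :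
    -- formulas for `S` and integrability conditions for a conformal Killing–Yano form
    (∀ h : ∀ x : M, TangentSpace (𝓡 n) x [⋀^Fin (k + 1)]→ₗ[ℝ] ℝ,
      CKY.IsConformalKillingYano g Y h →
      ∀ e ∈ IsManifold.maximalAtlas (𝓡 n) ∞ M, ∀ u ∈ e.target,
        (∀ B : Fin (k + 1) → Fin n,
          CKY.formComp h e u B = CKY.divergence (g.comp e) (CKY.formComp Y e) u B) ∧
        (∀ (c d : Fin n) (E : Fin k → Fin n),
          CKY.symDeriv (g.comp e) (CKY.formComp h e) u c d E
            = CKY.riemannExpr (g.comp e u) (CKY.riemann (g.comp e) u)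
                (CKY.formComp Y e u) c d E) ∧
        (∀ (c d : Fin n) (E : Fin k → Fin n),
          CKY.symDeriv (g.comp e) (CKY.formComp h e) u c d E
            = CKY.ricciWeylExpr (g.comp e u) (CKY.riemann (g.comp e) u)
                (CKY.formComp Y e u) c d E) ∧
        (∀ (a b c d : Fin n) (E : Fin k → Fin n),
          CKY.intCond (g.comp e u) (CKY.riemann (g.comp e) u) (CKY.formComp Y e u)
            (CKY.symDeriv (g.comp e) (CKY.formComp h e) u) a b c d E = 0) ∧
        (∀ (a b c d : Fin n) (E : Fin k → Fin n),
          CKY.intCond (g.comp e u) (CKY.riemann (g.comp e) u) (CKY.formComp Y e u)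
            (CKY.ricciWeylExpr (g.comp e u) (CKY.riemann (g.comp e) u) (CKY.formComp Y e u))
            a b c d E = 0) ∧
        (∀ (a b c d : Fin n) (E : Fin k → Fin n),
          CKY.intCond (g.comp e u) (CKY.weyl (g.comp e u) (CKY.riemann (g.comp e) u))
            (CKY.formComp Y e u)
            (CKY.weylExpr (g.comp e u) (CKY.riemann (g.comp e) u) (CKY.formComp Y e u))
            a b c d E = 0)) ∧
    -- cancellation of the Ricci and scalar-curvature terms, for every form `Y`
    (∀ e ∈ IsManifold.maximalAtlas (𝓡 n) ∞ M, ∀ u ∈ e.target,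
      ∀ (a b c d : Fin n) (E : Fin k → Fin n),
        CKY.intCond (g.comp e u) (CKY.riemann (g.comp e) u) (CKY.formComp Y e u)
            (CKY.ricciWeylExpr (g.comp e u) (CKY.riemann (g.comp e) u) (CKY.formComp Y e u))
            a b c d E
          = CKY.intCond (g.comp e u) (CKY.weyl (g.comp e u) (CKY.riemann (g.comp e) u))
              (CKY.formComp Y e u)
              (CKY.weylExpr (g.comp e u) (CKY.riemann (g.comp e) u) (CKY.formComp Y e u))
              a b c d E) ∧
    -- conformal invariance of `W`: it has weight `p - 1` when `Y` has weight `p + 1`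
    (∀ (g' : CKY.Metric n M) (Ω : M → ℝ), ContMDiff (𝓡 n) 𝓘(ℝ, ℝ) ∞ Ω → (∀ x, Ω x ≠ 0) →
      (∀ (x : M) (v w : TangentSpace (𝓡 n) x), g'.form x v w = Ω x ^ 2 * g.form x v w) →
      ∀ e ∈ IsManifold.maximalAtlas (𝓡 n) ∞ M, ∀ u ∈ e.target,
        ∀ (c d : Fin n) (E : Fin k → Fin n),
          CKY.weylExpr (g'.comp e u) (CKY.riemann (g'.comp e) u)
              (CKY.formComp (fun x => Ω x ^ (k + 3) • Y x) e u) c d E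
            = Ω (e.symm u) ^ (k + 1) *
              CKY.weylExpr (g.comp e u) (CKY.riemann (g.comp e) u)
                (CKY.formComp Y e u) c d E) := by
  have alg : ∀ e ∈ IsManifold.maximalAtlas (𝓡 n) ∞ M, ∀ u ∈ e.target,
      ∀ (a b c d : Fin n) (E : Fin k → Fin n),
        CKY.intCond (g.comp e u) (CKY.riemann (g.comp e) u) (CKY.formComp Y e u)
            (CKY.ricciWeylExpr (g.comp e u) (CKY.riemann (g.comp e) u) (CKY.formComp Y e u))
            a b c d E
          = CKY.intCond (g.comp e u) (CKY.weyl (g.comp e u) (CKY.riemann (g.comp e) u))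
              (CKY.formComp Y e u)
              (CKY.weylExpr (g.comp e u) (CKY.riemann (g.comp e) u) (CKY.formComp Y e u))
              a b c d E := by
    intro e he u hu a b c d E
    have hg := g.isMetricOn he
    exact CKY.intCond_ricciWeylExpr (hg.symm u hu) (hg.isUnit_det u hu) (hg.isCurvature hu)
      (CKY.isAlt_formComp Y u) (by omega) a b c d E
  refine ⟨fun h hh e he u hu => ?_, alg, fun g' Ω hΩ hΩ0 hgg' e he u hu c d E => ?_⟩
  · have hg := g.isMetricOn he
    have hC := hh.isCKYOn hY he
    have hA := CKY.isAlt_formComp (e := e) Y u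
    have hsym := hg.symm u hu
    have hdet := hg.isUnit_det u hu
    have hK := hg.isCurvature hu
    have hS : ∀ c d (E : Fin k → Fin n), CKY.symDeriv (g.comp e) (CKY.formComp h e) u c d E
        = CKY.symDeriv (g.comp e) (CKY.formComp h e) u d c E := fun c d E => add_comm _ _
    have hJ := hC.symCond hg (by omega) hu
    have hR := CKY.eq_riemannExpr_of_symCond hsym hdet hK hA hkn hS hJ
    have hRW : ∀ (c d : Fin n) (E : Fin k → Fin n),
        CKY.symDeriv (g.comp e) (CKY.formComp h e) u c d E
          = CKY.ricciWeylExpr (g.comp e u) (CKY.riemann (g.comp e) u)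
              (CKY.formComp Y e u) c d E := fun c d E =>
      (hR c d E).trans (CKY.riemannExpr_eq_ricciWeylExpr hdet hA hkn c d E)
    have hI : ∀ (a b c d : Fin n) (E : Fin k → Fin n),
        CKY.intCond (g.comp e u) (CKY.riemann (g.comp e) u) (CKY.formComp Y e u)
          (CKY.symDeriv (g.comp e) (CKY.formComp h e) u) a b c d E = 0 := by
      intro a b c d E
      have hN := CKY.covDeriv_isAlt (g := g.comp e) hg.isOpen hu (hC.smooth' hg (by omega)) hC.isAlt'
      have h3 := CKY.three_mul_intCond hsym hK hA hS
        (fun x y => ((hN x).vecCons y).add ((hN y).vecCons x)) a b c d E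
      rw [hJ, hJ] at h3
      linarith
    have hE : CKY.symDeriv (g.comp e) (CKY.formComp h e) u
        = CKY.ricciWeylExpr (g.comp e u) (CKY.riemann (g.comp e) u) (CKY.formComp Y e u) := by
      funext c d E; exact hRW c d E
    refine ⟨fun B => hC.eq_divergence hg (by omega) hu B, hR, hRW, hI, fun a b c d E => ?_,
      fun a b c d E => ?_⟩
    · rw [← hE]; exact hI a b c d E
    · rw [← alg e he u hu, ← hE]; exact hI a b c d E
  · have hg := g.isMetricOn he
    have hg' := g'.isMetricOn he
    have hsq : ∀ v ∈ e.target, ContDiffAt ℝ ∞ (fun v => Ω (e.symm v) ^ 2) v := fun v hv =>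
      (CKY.contDiffAt_comp_symm he hΩ hv).pow 2
    have h0 : ∀ v ∈ e.target, Ω (e.symm v) ^ 2 ≠ 0 := fun v _ => pow_ne_zero 2 (hΩ0 _)
    have hc : ∀ v ∈ e.target, g'.comp e v = Ω (e.symm v) ^ 2 • g.comp e v := fun v _ => by
      ext i j; exact hgg' _ _ _
    have hΩu := hΩ0 (e.symm u)
    -- Here w = Ω² and r = Ω^{p+1} = Ω^{k+3}, so the resulting weight w⁻¹ r is Ω^{k+1} = Ω^{p-1}.
    exact CKY.weylExpr_conformal (hg.isUnit_det u hu) (h0 u hu)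
      (r := Ω (e.symm u) ^ (k + 3)) (by field_simp; ring) (hc u hu)
      (CKY.weyl_conformal (hg.symm u hu) (hg.isUnit_det u hu)
        (hg.conformalTensor_symm hu (hsq u hu)) (by omega) (h0 u hu) (hc u hu)
        (hg.riemann_conformal hu hg' hsq h0 hc)) (fun _ => rfl) c d E
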